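/- Let $2\le k\le\infty$; "smooth" means $C^k$, and vector spaces and manifolds are real, of finite dimension $n\ge 2$. Definitions. For a vector space $V$, a set is conic if it contains $\lambda v$ for each of its elements $v$ and each $\lambda>0$. A (strong) cone in $V$ with interior $A_0$ is a non-empty embedded smooth hypersurface $\mathcal C_0\subset V\setminus\{0\}$ which is conic, salient ($v\in\mathcal C_0\Rightarrow -v\notin\mathcal C_0$), is the boundary in $V\setminus\{0\}$ of the open convex set $A_0\subset V\setminus\{0\}$, and is strongly convex in non-radial directions: at every $v\in\mathcal C_0$ the second fundamental form of $\mathcal C_0$ with respect to transverse vectors pointing into $A_0$ is positive semi-definite with radical $\mathbb R v$. A properly Lorentz–Minkowski norm on $V$ is a positive smooth function $L$ on a non-empty, open, connected, conic set $A_0\subset V\setminus\{0\}$ such that $L(\lambda v)=\lambda^2L(v)$ for $\lambda>0$; the fundamental tensor $g_v(u,w)=\frac12\frac{\partial^2}{\partial r\,\partial s}L(v+ru+sw)|_{r=s=0}$ is non-degenerate of index $n-1$ (the maximal dimension of a subspace on which it is negative definite) for all $v\in A_0$; the closure of $A_0$ in $V\setminus\{0\}$ is a smooth manifold with boundary, its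 boundary being the topological boundary $\mathcal C_0$ of $A_0$ in $V\setminus\{0\}$; and $L$ extends smoothly as zero to $\mathcal C_0$, with non-degenerate fundamental tensor there. For a manifold $M$ of class $C^{k+1}$ write $A_p=A\cap T_pM$ for $A\subset TM$. A Lorentz–Finsler metric on $M$ is a positive smooth function $L$ on an open set $A\subset TM\setminus\mathbf 0$ with every $A_p$ non-empty, conic and connected, such that the closure of $A$ in $TM\setminus\mathbf 0$ is an embedded smooth manifold with boundary, its boundary being the topological boundary $\mathcal C$ of $A$ in $TM\setminus\mathbf 0$; $L$ extends smoothly as zero to $\mathcal C$; and $L|_{A_p}$ is a properly Lorentz–Minkowski norm on $T_pM$ for every $p\in M$. A (strong) cone structure on $M$ with cone domain $A$ is an embedded smooth hypersurface $\mathcal C$ of $TM$, transverse to the fibres of $TM$, such that for every $p\in M$ the set $\mathcal C\cap T_pM$ is a strong cone in $T_pM$ with interior $A_p$. Theorem. (1) If $L:A_0\to(0,\infty)$ is a properly Lorentz–Minkowski norm on $V$, then the boundary $\mathcal C_0$ of $A_0$ in $V\setminus\{0\}$ is a strong cone with interior $A_0$ (in particular it is salient, strongly convex in non-radial directions, and has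 convex interior). (2) If $L:A\to(0,\infty)$ is a Lorentz–Finsler metric on $M$, then the boundary $\mathcal C$ of $A$ in $TM\setminus\mathbf 0$ is a strong cone structure on $M$ with cone domain $A$. -/

import Mathlib

open Set Module
open scoped Manifold ContDiff

/-! ### Hypersurfaces and cones in a vector space -/

section VectorSpace

variable {V : Type*} [NormedAddCommGroup V] [NormedSpace ℝ V]

/-- The set contains, with each vector, its whole open half-line. -/
def IsConic (A : Set V) : Prop :=
  ∀ v ∈ A, ∀ r : ℝ, 0 < r → r • v ∈ A

/-- The boundary of `A` in `V ∖ {0}`. -/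
def puncturedBoundary (A : Set V) : Set V :=
  frontier A \ {0}

/-- `φ` is a `C^k` function on the open neighbourhood `U` of `v`, regular at `v`, whose zero set
is `S` inside `U`. -/
structure IsLocalDefiningFunction (k : ℕ∞) (S : Set V) (v : V) (U : Set V) (φ : V → ℝ) :
    Prop where
  isOpen : IsOpen U
  mem : v ∈ U
  contDiffOn : ContDiffOn ℝ k φ U
  fderiv_ne_zero : fderiv ℝ φ v ≠ 0
  inter_eq : S ∩ U = {x ∈ U | φ x = 0}

/-- `S` is an embedded `C^k` hypersurface: it is locally the zero set of a regular `C^k`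
function. -/
def IsEmbeddedHypersurface (k : ℕ∞) (S : Set V) : Prop :=
  ∀ v ∈ S, ∃ (U : Set V) (φ : V → ℝ), IsLocalDefiningFunction k S v U φ

/-- The closure of the open set `A` in `V ∖ {0}` is an embedded `C^k` manifold with boundary, whose
boundary is the topological boundary of `A` in `V ∖ {0}`: near each boundary point `A` is
`{φ > 0}` and its boundary is `{φ = 0}`, for a regular `C^k` function `φ`. -/
def HasSmoothPuncturedBoundary (k : ℕ∞) (A : Set V) : Prop :=
  ∀ v ∈ puncturedBoundary A, ∃ (U : Set V) (φ : V → ℝ),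
    IsLocalDefiningFunction k (puncturedBoundary A) v U φ ∧ A ∩ U = {x ∈ U | 0 < φ x}

/-- `N`, placed at `v`, points to `A`. -/
def PointsInto (A : Set V) (v N : V) : Prop :=
  ∃ ε : ℝ, 0 < ε ∧ ∀ t : ℝ, 0 < t → t < ε → v + t • N ∈ A

/-- The second fundamental form `σ^N(X, Y)` at `v`, with respect to the transverse vector `N`, of
the affine hypersurface with local defining function `φ`; here `X, Y` are tangent, that is, they lie
in the kernel of `dφ_v`. It is the coefficient in the Gauss formula `D_X Y = ∇_X Y + σ^N(X, Y) N`: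
differentiating `dφ(Y) = 0` along `X` gives `d²φ(X, Y) + σ^N(X, Y) dφ(N) = 0`. -/
noncomputable def secondFundamentalForm (φ : V → ℝ) (v N X Y : V) : ℝ :=
  -(fderiv ℝ (fderiv ℝ φ) v X Y) / fderiv ℝ φ v N

/-- Non-radial strong convexity of the hypersurface `C` towards `A`: at each `v ∈ C` the second
fundamental form with respect to inner transverse directions is positive semi-definite on the
tangent space, and its radical is the line spanned by `v`. (The form does not depend on the chosen
local defining function.) -/
def IsNonRadiallyStronglyConvex (C A : Set V) : Prop :=
  ∀ v ∈ C, ∀ (U : Set V) (φ : V → ℝ), IsLocalDefiningFunction 2 C v U φ →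
    ∀ N : V, PointsInto A v N → fderiv ℝ φ v N ≠ 0 →
      (∀ X : V, fderiv ℝ φ v X = 0 → 0 ≤ secondFundamentalForm φ v N X X) ∧
      ∀ X : V, (fderiv ℝ φ v X = 0 ∧
          ∀ Y : V, fderiv ℝ φ v Y = 0 → secondFundamentalForm φ v N X Y = 0) ↔
        X ∈ Submodule.span ℝ {v}

/-- `C` is a weak cone of class `C^k` whose `C`-interior is `A`. -/
structure IsWeakCone (k : ℕ∞) (C A : Set V) : Prop where
  nonempty : C.Nonempty
  zero_notMem : (0 : V) ∉ C
  hypersurface : IsEmbeddedHypersurface k C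
  conic : IsConic C
  salient : ∀ v ∈ C, -v ∉ C
  isOpen_interior : IsOpen A
  zero_notMem_interior : (0 : V) ∉ A
  eq_boundary : C = puncturedBoundary A
  convex_interior : Convex ℝ A

/-- `C` is a (strong) cone of class `C^k` whose `C`-interior is `A`. -/
structure IsStrongCone (k : ℕ∞) (C A : Set V) : Prop extends IsWeakCone k C A where
  strongly_convex : IsNonRadiallyStronglyConvex C A

/-! ### Lorentz-Minkowski norms -/

/-- The fundamental tensor `g_v(u, w) = ½ ∂²/∂r∂s L(v + r u + s w)` at `r = s = 0`, that is, one half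
of the second differential of `L` at `v`. -/
noncomputable def fundamentalTensor (L : V → ℝ) (v u w : V) : ℝ :=
  (1 / 2 : ℝ) * fderiv ℝ (fderiv ℝ L) v u w

/-- The bilinear form `b` is nondegenerate. -/
def IsNondegenerateForm (b : V → V → ℝ) : Prop :=
  ∀ u : V, (∀ w : V, b u w = 0) → u = 0

/-- `b` is negative definite on the subspace `W`. -/
def IsNegDefOn (b : V → V → ℝ) (W : Submodule ℝ V) : Prop :=
  ∀ w ∈ W, w ≠ 0 → b w w < 0

/-- The index of `b`, the largest dimension of a subspace on which `b` is negative definite,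
is `m`. -/
def HasIndex (b : V → V → ℝ) (m : ℕ) : Prop :=
  (∃ W : Submodule ℝ V, IsNegDefOn b W ∧ finrank ℝ W = m) ∧
    ∀ W : Submodule ℝ V, IsNegDefOn b W → finrank ℝ W ≤ m

/-- `L`, restricted to `A ⊆ V ∖ {0}`, is a (conic, two-homogeneous) pseudo-Minkowski norm of class
`C^k`. The values of `L` outside `A` play no role. -/
structure IsPseudoMinkowskiNorm (k : ℕ∞) (A : Set V) (L : V → ℝ) : Prop where
  nonempty : A.Nonempty
  zero_notMem : (0 : V) ∉ A
  isOpen : IsOpen A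
  conic : IsConic A
  contDiffOn : ContDiffOn ℝ k L A
  homogeneous : ∀ v ∈ A, ∀ r : ℝ, 0 < r → L (r • v) = r ^ 2 * L v
  nondegenerate : ∀ v ∈ A, IsNondegenerateForm (fundamentalTensor L v)

/-- `L : A → (0, ∞)` is a Lorentz-Minkowski norm of class `C^k`. -/
structure IsLorentzMinkowskiNorm (k : ℕ∞) (A : Set V) (L : V → ℝ) : Prop
    extends IsPseudoMinkowskiNorm k A L where
  pos : ∀ v ∈ A, 0 < L v
  connected : IsConnected A
  index : ∀ v ∈ A, HasIndex (fundamentalTensor L v) (finrank ℝ V - 1)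

/-- `L : A → (0, ∞)` is a properly Lorentz-Minkowski norm of class `C^k`: the closure of `A` in
`V ∖ {0}` is a manifold with boundary and `L` extends smoothly as zero to the boundary, with
nondegenerate fundamental tensor there. Smoothness up to the boundary means that `L` has a `C^k`
extension to a neighbourhood of each boundary point. -/
structure IsProperlyLorentzMinkowskiNorm (k : ℕ∞) (A : Set V) (L : V → ℝ) : Prop
    extends IsLorentzMinkowskiNorm k A L where
  smooth_boundary : HasSmoothPuncturedBoundary k A
  extends_zero : ∀ v ∈ puncturedBoundary A, ∃ (U : Set V) (f : V → ℝ),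
    IsOpen U ∧ v ∈ U ∧ ContDiffOn ℝ k f U ∧ (∀ x ∈ A ∩ U, f x = L x) ∧
      (∀ x ∈ puncturedBoundary A ∩ U, f x = 0) ∧ IsNondegenerateForm (fundamentalTensor f v)

end VectorSpace

/-! ### Cone structures and Lorentz-Finsler metrics on a manifold

The tangent space of `M` at `p` is, as a vector space with its topology, the model space `E`. -/

section TangentBundle

variable {E : Type*} [NormedAddCommGroup E] [NormedSpace ℝ E]
  {M : Type*} [TopologicalSpace M] [ChartedSpace E M]

/-- The fibre `A ∩ T_pM`, as a set of tangent vectors at `p`. -/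
def fibreAt (A : Set (TangentBundle 𝓘(ℝ, E) M)) (p : M) : Set E :=
  {w : E | (⟨p, w⟩ : TangentBundle 𝓘(ℝ, E) M) ∈ A}

/-- The zero section of `TM`. -/
def zeroSectionSet (E : Type*) [NormedAddCommGroup E] [NormedSpace ℝ E]
    (M : Type*) [TopologicalSpace M] [ChartedSpace E M] : Set (TangentBundle 𝓘(ℝ, E) M) :=
  {v | v.2 = 0}

variable [IsManifold 𝓘(ℝ, E) 1 M]

/-- The boundary of `A` in `TM ∖ 𝟎`. -/
def tangentBoundary (A : Set (TangentBundle 𝓘(ℝ, E) M)) : Set (TangentBundle 𝓘(ℝ, E) M) :=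
  frontier A \ zeroSectionSet E M

/-- `φ` is a `C^k` function on the open neighbourhood `U` of `v` in `TM`, regular at `v`, whose zero
set is `S` inside `U`. -/
structure IsTangentLocalDefiningFunction (k : ℕ∞) (S : Set (TangentBundle 𝓘(ℝ, E) M))
    (v : TangentBundle 𝓘(ℝ, E) M) (U : Set (TangentBundle 𝓘(ℝ, E) M))
    (φ : TangentBundle 𝓘(ℝ, E) M → ℝ) : Prop where
  isOpen : IsOpen U
  mem : v ∈ U
  contMDiffOn : ContMDiffOn 𝓘(ℝ, E).tangent 𝓘(ℝ, ℝ) k φ U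
  mfderiv_ne_zero : mfderiv 𝓘(ℝ, E).tangent 𝓘(ℝ, ℝ) φ v ≠ 0
  inter_eq : S ∩ U = {x ∈ U | φ x = 0}

/-- `S` is an embedded `C^k` hypersurface of `TM`. -/
def IsTangentEmbeddedHypersurface (k : ℕ∞) (S : Set (TangentBundle 𝓘(ℝ, E) M)) : Prop :=
  ∀ v ∈ S, ∃ (U : Set (TangentBundle 𝓘(ℝ, E) M)) (φ : TangentBundle 𝓘(ℝ, E) M → ℝ),
    IsTangentLocalDefiningFunction k S v U φ

/-- The closure of the open set `A` in `TM ∖ 𝟎` is an embedded `C^k` manifold with boundary, whose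
boundary is the topological boundary of `A` in `TM ∖ 𝟎`. -/
def HasSmoothTangentBoundary (k : ℕ∞) (A : Set (TangentBundle 𝓘(ℝ, E) M)) : Prop :=
  ∀ v ∈ tangentBoundary A,
    ∃ (U : Set (TangentBundle 𝓘(ℝ, E) M)) (φ : TangentBundle 𝓘(ℝ, E) M → ℝ),
      IsTangentLocalDefiningFunction k (tangentBoundary A) v U φ ∧ A ∩ U = {x ∈ U | 0 < φ x}

/-- The hypersurface `S` is transverse to the fibres of `TM`: at each `v ∈ S`, the vertical space
(the kernel of the differential of the projection, which is the tangent space to the fibre) and the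
tangent space to `S` (the kernel of the differential of a local defining function) span
`T_v(TM)`. -/
def IsTransverseToFibres (k : ℕ∞) (S : Set (TangentBundle 𝓘(ℝ, E) M)) : Prop :=
  ∀ v ∈ S, ∀ (U : Set (TangentBundle 𝓘(ℝ, E) M)) (φ : TangentBundle 𝓘(ℝ, E) M → ℝ),
    IsTangentLocalDefiningFunction k S v U φ →
      LinearMap.ker (mfderiv 𝓘(ℝ, E).tangent 𝓘(ℝ, E)
          (fun x : TangentBundle 𝓘(ℝ, E) M => x.proj) v).toLinearMap ⊔
        LinearMap.ker (mfderiv 𝓘(ℝ, E).tangent 𝓘(ℝ, ℝ) φ v).toLinearMap = ⊤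

/-- `C ⊆ TM` is a (strong) cone structure of class `C^k` on `M` with cone domain `A`. -/
structure IsConeStructure (k : ℕ∞) (C A : Set (TangentBundle 𝓘(ℝ, E) M)) : Prop where
  hypersurface : IsTangentEmbeddedHypersurface k C
  transverse : IsTransverseToFibres k C
  strongCone : ∀ p : M, IsStrongCone k (fibreAt C p) (fibreAt A p)

/-- `L : A → (0, ∞)` is a Lorentz-Finsler metric of class `C^k` on `M`, with domain the conic domain
`A ⊆ TM ∖ 𝟎`. The values of `L` outside `A` play no role; smoothness up to the boundary means that
`L` has a `C^k` extension to a neighbourhood of each boundary point. -/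
structure IsLorentzFinslerMetric (k : ℕ∞) (A : Set (TangentBundle 𝓘(ℝ, E) M))
    (L : TangentBundle 𝓘(ℝ, E) M → ℝ) : Prop where
  isOpen : IsOpen A
  zero_notMem : ∀ v ∈ A, v ∉ zeroSectionSet E M
  conic : ∀ p : M, IsConic (fibreAt A p)
  connected : ∀ p : M, IsConnected (fibreAt A p)
  smooth_boundary : HasSmoothTangentBoundary k A
  pos : ∀ v ∈ A, 0 < L v
  contMDiffOn : ContMDiffOn 𝓘(ℝ, E).tangent 𝓘(ℝ, ℝ) k L A
  extends_zero : ∀ v ∈ tangentBoundary A,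
    ∃ (U : Set (TangentBundle 𝓘(ℝ, E) M)) (f : TangentBundle 𝓘(ℝ, E) M → ℝ),
      IsOpen U ∧ v ∈ U ∧ ContMDiffOn 𝓘(ℝ, E).tangent 𝓘(ℝ, ℝ) k f U ∧
        (∀ x ∈ A ∩ U, f x = L x) ∧ ∀ x ∈ tangentBoundary A ∩ U, f x = 0
  properlyLorentzMinkowski : ∀ p : M, IsProperlyLorentzMinkowskiNorm k (fibreAt A p)
    (fun w : E => L (⟨p, w⟩ : TangentBundle 𝓘(ℝ, E) M))

end TangentBundle

open Filter Topology

/-! ### Second-order calculus: level sets, limits of derivatives, concavity of square roots -/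

section Calculus

variable {V : Type*} [NormedAddCommGroup V] [NormedSpace ℝ V]

/-! Index `n - 1` and `L > 0` give a reverse Cauchy-Schwarz inequality for `d²L`. By Euler's
identities `d²L_x(x, ·) = dL_x` and `dL_x(x) = 2L(x)` it reads `2L·d²L(w, w) ≤ dL(w)²`, so `√L` is
concave along segments in `A`. Extended by zero, `√L` is continuous on `V` and positive exactly on
`A`, so connectedness upgrades to convexity (`convex_of_quasiconcave_on_segments`).

At a boundary point `v`, Euler's identities and the inequality pass to a `C²` extension `f` of `L`
(`exists_isLorentzExtension`). Nondegeneracy gives `df_v = d²f_v(v, ·) ≠ 0`, so the tangent space is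
the orthogonal of the null vector `v`. There `d²f_v` is negative semi-definite with radical `ℝv`,
which is strong convexity. If `-v` were also a boundary point, concavity would force `f` to vanish
to second order at `v` in the directions of `A`, hence `df_v = 0`.

On a manifold, the point is that the boundary of `A` meets each fibre exactly in the boundary of
`A_p` (`fibreAt_tangentBoundary`): fibrewise concavity keeps `L` away from zero on points contracted
towards an interior vector field, even in the limit between fibres. Transversality follows since
`df` is already nonzero along the fibre. -/

theorem ContDiffAt.hasFDerivAt_fderiv {f : V → ℝ} {v : V} (hf : ContDiffAt ℝ 2 f v) :
    HasFDerivAt (fderiv ℝ f) (fderiv ℝ (fderiv ℝ f) v) v := by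
  have h : ContDiffAt ℝ 1 (fderiv ℝ f) v := hf.fderiv_right (by norm_num)
  exact (h.differentiableAt (by norm_num)).hasFDerivAt

theorem ContDiffAt.eventually_hasFDerivAt {f : V → ℝ} {v : V} (hf : ContDiffAt ℝ 2 f v) :
    ∀ᶠ x in 𝓝 v, HasFDerivAt f (fderiv ℝ f x) x := by
  filter_upwards [hf.eventually (by simp)] with x hx
  exact (hx.differentiableAt (by norm_num)).hasFDerivAt

theorem ContDiffAt.fderiv_fderiv_comm {f : V → ℝ} {v : V} (hf : ContDiffAt ℝ 2 f v) (x y : V) :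
    fderiv ℝ (fderiv ℝ f) v x y = fderiv ℝ (fderiv ℝ f) v y x :=
  (hf.isSymmSndFDerivAt (by simp)).eq x y

theorem ContDiffAt.continuousAt_fderiv_fderiv {f : V → ℝ} {v : V} (hf : ContDiffAt ℝ 2 f v) :
    ContinuousAt (fderiv ℝ (fderiv ℝ f)) v := by
  have h : ContDiffAt ℝ 1 (fderiv ℝ f) v := hf.fderiv_right (by norm_num)
  exact (h.fderiv_right (m := 0) (by norm_num)).continuousAt

/-- First and second derivatives of a function along a curve on which it vanishes. -/
theorem fderiv_of_eventually_comp_eq_zero {f : V → ℝ} {γ : ℝ → V} {v : V} (hγ : ContDiffAt ℝ 2 γ 0)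
    (h0 : γ 0 = v) (hf : ContDiffAt ℝ 2 f v) (hz : ∀ᶠ t in 𝓝 (0 : ℝ), f (γ t) = 0) :
    fderiv ℝ f v (deriv γ 0) = 0 ∧
      fderiv ℝ (fderiv ℝ f) v (deriv γ 0) (deriv γ 0) + fderiv ℝ f v (deriv (deriv γ) 0) = 0 := by
  subst h0
  have hγ' : ∀ᶠ t in 𝓝 (0 : ℝ), HasDerivAt γ (deriv γ t) t := by
    filter_upwards [hγ.eventually (by simp)] with t ht
    exact (ht.differentiableAt (by norm_num)).hasDerivAt
  have hγ'' : HasDerivAt (deriv γ) (deriv (deriv γ) 0) 0 := by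
    have : ContDiffAt ℝ 1 (deriv γ) 0 := by
      have h1 : ContDiffAt ℝ 1 (fderiv ℝ γ) 0 := hγ.fderiv_right (by norm_num)
      have h2 : deriv γ = fun t => fderiv ℝ γ t 1 := by
        ext t; simp
      rw [h2]
      exact h1.clm_apply contDiffAt_const
    exact (this.differentiableAt (by norm_num)).hasDerivAt
  have hg : ∀ᶠ t in 𝓝 (0 : ℝ), fderiv ℝ f (γ t) (deriv γ t) = 0 := by
    filter_upwards [hγ', hγ.continuousAt.eventually hf.eventually_hasFDerivAt,
      hz.eventually_nhds] with t h1 h2 h3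
    have h4 := h2.comp_hasDerivAt t h1
    have h5 : HasDerivAt (f ∘ γ) 0 t :=
      (hasDerivAt_const t (0 : ℝ)).congr_of_eventuallyEq h3
    exact h4.unique h5
  refine ⟨hg.self_of_nhds, ?_⟩
  have h1 : HasDerivAt (fun t => fderiv ℝ f (γ t))
      (fderiv ℝ (fderiv ℝ f) (γ 0) (deriv γ 0)) 0 :=
    hf.hasFDerivAt_fderiv.comp_hasDerivAt 0 hγ'.self_of_nhds
  have h2 := h1.clm_apply hγ''
  exact h2.unique ((hasDerivAt_const (0 : ℝ) (0 : ℝ)).congr_of_eventuallyEq hg)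

/-- Every tangent vector of a regular level set is the velocity of a curve in it. -/
theorem exists_curve_in_zero_set [CompleteSpace V] {φ : V → ℝ} {v : V} (hφ : ContDiffAt ℝ 2 φ v)
    (h0 : φ v = 0) (hd : fderiv ℝ φ v ≠ 0) {X : V} (hX : fderiv ℝ φ v X = 0) :
    ∃ γ : ℝ → V, ContDiffAt ℝ 2 γ 0 ∧ γ 0 = v ∧ deriv γ 0 = X ∧
      ∀ᶠ t in 𝓝 (0 : ℝ), φ (γ t) = 0 := by
  obtain ⟨N, hN⟩ : ∃ N, fderiv ℝ φ v N = 1 := by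
    obtain ⟨N, hN⟩ : ∃ N, fderiv ℝ φ v N ≠ 0 := by
      by_contra! h
      exact hd (ContinuousLinearMap.ext h)
    exact ⟨(fderiv ℝ φ v N)⁻¹ • N, by simp [hN]⟩
  set ℓ := fderiv ℝ φ v with hℓ
  -- `Ψ` has derivative the identity at `v` and satisfies `ℓ (Ψ x - v) = φ x`, so its local inverse
  -- carries the hyperplane `v + ker ℓ` into `{φ = 0}`; the curve is the image of the line `v + t
  -- X`.
  let Ψ : V → V := fun x => x + (φ x - ℓ (x - v)) • N
  have hΨ : ContDiffAt ℝ 2 Ψ v :=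
    contDiffAt_id.add ((hφ.sub (ℓ.contDiff.contDiffAt.comp v
      (contDiffAt_id.sub contDiffAt_const))).smul contDiffAt_const)
  have hΨv : Ψ v = v := by simp [Ψ, h0]
  have hΨ' : HasFDerivAt Ψ ((ContinuousLinearEquiv.refl ℝ V : V ≃L[ℝ] V) : V →L[ℝ] V) v := by
    have h1 : HasFDerivAt φ ℓ v := (hφ.differentiableAt (by norm_num)).hasFDerivAt
    have h2 : HasFDerivAt (fun x => ℓ (x - v)) ℓ v := by
      exact ℓ.hasFDerivAt.comp v ((hasFDerivAt_id v).sub_const v)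
    have h3 := (hasFDerivAt_id v).add ((h1.sub h2).smul_const N)
    convert! h3 using 1
    ext x; simp
  have hφΨ : ∀ x, ℓ (Ψ x - v) = φ x := by
    intro x
    simp only [Ψ, map_sub, map_add, map_smul, hN, smul_eq_mul]
    ring
  have hs := hΨ.hasStrictFDerivAt' hΨ' (by norm_num)
  have hinv := hs.eventually_right_inverse
  have hχ := hΨ.to_localInverse hΨ' (by norm_num)
  have hχ0 := hΨ.localInverse_apply_image hΨ' (by norm_num)
  have hχ' : HasFDerivAt (hΨ.localInverse hΨ' (by norm_num)) _ (Ψ v) :=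
    hs.to_localInverse.hasFDerivAt
  set χ := hΨ.localInverse hΨ' (by norm_num)
  rw [hΨv] at hinv hχ hχ0 hχ'
  let c : ℝ → V := fun t => v + t • X
  have hc0 : c 0 = v := by simp [c]
  have hc : ContDiff ℝ 2 c := contDiff_const.add (contDiff_id.smul contDiff_const)
  have hc' : HasDerivAt c X 0 := by
    have := ((hasDerivAt_id (0 : ℝ)).smul_const X).const_add v
    rwa [one_smul] at this
  refine ⟨χ ∘ c, ?_, by simp [hc0, hχ0], ?_, ?_⟩
  · exact ContDiffAt.comp 0 (by rw [hc0]; exact hχ) hc.contDiffAt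
  · rw [← hc0] at hχ'
    have := hχ'.comp_hasDerivAt 0 hc'
    simpa using this.deriv
  · have h1 : Tendsto c (𝓝 0) (𝓝 v) := by
      have := hc.continuous.tendsto 0
      rwa [hc0] at this
    filter_upwards [h1.eventually hinv] with t ht
    rw [← hφΨ, Function.comp_apply]
    have : Ψ (χ (c t)) = c t := ht
    rw [this]
    simp [c, hX]

theorem exists_smul_of_ker_le (ℓ m : V →L[ℝ] ℝ) (hℓ : ℓ ≠ 0) (h : ∀ x, ℓ x = 0 → m x = 0) :
    ∃ c : ℝ, m = c • ℓ := by
  obtain ⟨N, hN⟩ : ∃ N, ℓ N ≠ 0 := by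
    by_contra! h
    exact hℓ (ContinuousLinearMap.ext h)
  refine ⟨m N / ℓ N, ?_⟩
  ext x
  have h1 := h (x - (ℓ x / ℓ N) • N) (by simp [hN])
  simp only [map_sub, map_smul, smul_eq_mul] at h1
  simp only [smul_apply, smul_eq_mul]
  rw [sub_eq_zero.mp h1]
  field_simp

/-- Two functions, the first one regular and the second one vanishing where the first one does:
their differentials, and their second differentials on the tangent space, are proportional. -/
theorem exists_smul_of_zero_set_subset [CompleteSpace V] {φ f : V → ℝ} {v : V}
    (hφ : ContDiffAt ℝ 2 φ v) (hf : ContDiffAt ℝ 2 f v) (h0 : φ v = 0) (hd : fderiv ℝ φ v ≠ 0)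
    (hz : ∀ᶠ x in 𝓝 v, φ x = 0 → f x = 0) :
    ∃ c : ℝ, fderiv ℝ f v = c • fderiv ℝ φ v ∧ ∀ X Y, fderiv ℝ φ v X = 0 → fderiv ℝ φ v Y = 0 →
      fderiv ℝ (fderiv ℝ f) v X Y = c * fderiv ℝ (fderiv ℝ φ) v X Y := by
  -- One curve in `{φ = 0}` serves both functions, so the same acceleration `Z` occurs in both
  -- second-order identities and can be eliminated; polarization then gives the off-diagonal values.
  have key : ∀ X, fderiv ℝ φ v X = 0 → fderiv ℝ f v X = 0 ∧ ∃ Z,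
      fderiv ℝ (fderiv ℝ φ) v X X + fderiv ℝ φ v Z = 0 ∧
      fderiv ℝ (fderiv ℝ f) v X X + fderiv ℝ f v Z = 0 := by
    intro X hX
    obtain ⟨γ, hγ, hγ0, hγ', hγz⟩ := exists_curve_in_zero_set hφ h0 hd hX
    have h1 := fderiv_of_eventually_comp_eq_zero hγ hγ0 hφ hγz
    have hγf : ∀ᶠ t in 𝓝 (0 : ℝ), f (γ t) = 0 := by
      have hγc : Tendsto γ (𝓝 0) (𝓝 v) := hγ0 ▸ hγ.continuousAt
      filter_upwards [hγz, hγc.eventually hz] with t h1 h2 using h2 h1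
    have h2 := fderiv_of_eventually_comp_eq_zero hγ hγ0 hf hγf
    rw [hγ'] at h1 h2
    exact ⟨h2.1, _, h1.2, h2.2⟩
  obtain ⟨c, hc⟩ := exists_smul_of_ker_le _ _ hd fun X hX => (key X hX).1
  have hdiag : ∀ X, fderiv ℝ φ v X = 0 →
      fderiv ℝ (fderiv ℝ f) v X X = c * fderiv ℝ (fderiv ℝ φ) v X X := by
    intro X hX
    obtain ⟨-, Z, h1, h2⟩ := key X hX
    rw [hc, smul_apply, smul_eq_mul] at h2
    linear_combination h2 - c * h1
  refine ⟨c, hc, fun X Y hX hY => ?_⟩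
  have h1 := hdiag (X + Y) (by simp [hX, hY])
  simp only [map_add, add_apply] at h1
  rw [hf.fderiv_fderiv_comm Y X, hφ.fderiv_fderiv_comm Y X] at h1
  linear_combination h1 / 2 - hdiag X hX / 2 - hdiag Y hY / 2

theorem fderiv_eq_of_eventually_eq_of_mem_closure {f g : V → ℝ} {v : V} {A : Set V} (hA : IsOpen A)
    (hf : ContDiffAt ℝ 2 f v) (hg : ContDiffAt ℝ 2 g v) (hv : v ∈ closure A)
    (h : ∀ᶠ x in 𝓝 v, x ∈ A → f x = g x) : fderiv ℝ f v = fderiv ℝ g v := by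
  have h1 : ∀ᶠ x in 𝓝 v, x ∈ A → fderiv ℝ f x = fderiv ℝ g x := by
    filter_upwards [h.eventually_nhds] with x hx hxA
    apply Filter.EventuallyEq.fderiv_eq
    filter_upwards [hx, hA.mem_nhds hxA] with y h1 h2 using h1 h2
  have hcf : ContinuousAt (fderiv ℝ f) v := hf.hasFDerivAt_fderiv.continuousAt
  have hcg : ContinuousAt (fderiv ℝ g) v := hg.hasFDerivAt_fderiv.continuousAt
  have : (𝓝[A] v).NeBot := mem_closure_iff_nhdsWithin_neBot.mp hv
  refine tendsto_nhds_unique_of_eventuallyEq (hcf.mono_left (nhdsWithin_le_nhds (s := A)))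
    (hcg.mono_left nhdsWithin_le_nhds) ?_
  rw [EventuallyEq, eventually_nhdsWithin_iff]
  exact h1

/-- The square root of a positive function `h` with `2 h h'' ≤ h'²` is concave. -/
theorem concaveOn_sqrt_of_deriv {D : Set ℝ} (hD : Convex ℝ D) {h h' h'' : ℝ → ℝ}
    (h1 : ∀ t ∈ D, HasDerivAt h (h' t) t) (h2 : ∀ t ∈ D, HasDerivAt h' (h'' t) t)
    (hpos : ∀ t ∈ D, 0 < h t) (hle : ∀ t ∈ D, 2 * h t * h'' t ≤ h' t ^ 2) :
    ConcaveOn ℝ D fun t => √(h t) := by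
  have hs : ∀ t ∈ D, HasDerivAt (fun t => √(h t)) (h' t / (2 * √(h t))) t :=
    fun t ht => (h1 t ht).sqrt (hpos t ht).ne'
  refine concaveOn_of_hasDerivWithinAt2_nonpos hD
    (fun t ht => (hs t ht).continuousAt.continuousWithinAt)
    (f' := fun t => h' t / (2 * √(h t)))
    (f'' := fun t => (h'' t * (2 * √(h t)) - h' t * (2 * (h' t / (2 * √(h t))))) / (2 * √(h t)) ^ 2)
    (fun t ht => (hs t (interior_subset ht)).hasDerivWithinAt) (fun t ht => ?_) fun t ht => ?_
  · have ht' := interior_subset ht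
    have hne : 2 * √(h t) ≠ 0 := by
      have := Real.sqrt_pos.mpr (hpos t ht')
      positivity
    exact ((h2 t ht').div ((hs t ht').const_mul 2) hne).hasDerivWithinAt
  · have ht' := interior_subset ht
    have hsq := Real.sqrt_pos.mpr (hpos t ht')
    refine div_nonpos_of_nonpos_of_nonneg ?_ (by positivity)
    have h3 : √(h t) ^ 2 = h t := Real.sq_sqrt (hpos t ht').le
    have h4 : h'' t * (2 * √(h t)) - h' t * (2 * (h' t / (2 * √(h t))))
        = (2 * h t * h'' t - h' t ^ 2) / √(h t) := by
      field_simp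
      rw [h3]
    rw [h4]
    exact div_nonpos_of_nonpos_of_nonneg (by linarith [hle t ht']) hsq.le

end Calculus

/-! ### Lorentzian bilinear forms -/

section Lorentz

variable {V : Type*} [NormedAddCommGroup V] [NormedSpace ℝ V]

/-- The bilinear form satisfies the reverse Cauchy-Schwarz inequality. -/
def IsReverseCauchySchwarz (B : V →L[ℝ] V →L[ℝ] ℝ) : Prop :=
  ∀ x y : V, 0 < B x x → B x x * B y y ≤ B x y ^ 2

/-- A vector `x` with `B x x > 0` spans a complement of `W`, so some `y - t x` lies in `W`. Hence
the quadratic `s ↦ B (y - s x) (y - s x)`, with positive leading coefficient, takes a nonpositive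
value, and its discriminant is nonnegative. -/
theorem isReverseCauchySchwarz_of_isNegDefOn [FiniteDimensional ℝ V] {B : V →L[ℝ] V →L[ℝ] ℝ}
    (hB : ∀ x y, B x y = B y x) {W : Submodule ℝ V} (hW : ∀ w ∈ W, w ≠ 0 → B w w < 0)
    (hdim : finrank ℝ V ≤ finrank ℝ W + 1) : IsReverseCauchySchwarz B := by
  intro x y hx
  have hxW : x ∉ W := fun h => by
    have : x ≠ 0 := by rintro rfl; simp at hx
    exact (hW x h this).not_gt hx
  obtain ⟨t, ht⟩ : ∃ t : ℝ, y - t • x ∈ W := by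
    have hlt : W < W ⊔ Submodule.span ℝ {x} := by
      refine lt_of_le_of_ne le_sup_left fun h => hxW ?_
      rw [h]
      exact Submodule.mem_sup_right (Submodule.mem_span_singleton_self x)
    have h1 := Submodule.finrank_lt_finrank_of_lt hlt
    have htop : W ⊔ Submodule.span ℝ {x} = ⊤ :=
      Submodule.eq_top_of_finrank_eq (le_antisymm (Submodule.finrank_le _) (by omega))
    have hy : y ∈ W ⊔ Submodule.span ℝ {x} := htop ▸ Submodule.mem_top
    obtain ⟨w, hw, z, hz, rfl⟩ := Submodule.mem_sup.mp hy
    obtain ⟨t, rfl⟩ := Submodule.mem_span_singleton.mp hz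
    exact ⟨t, by simpa using hw⟩
  have hle : B (y - t • x) (y - t • x) ≤ 0 := by
    by_cases h : y - t • x = 0
    · simp [h]
    · exact (hW _ ht h).le
  simp only [map_sub, map_smul, sub_apply, smul_apply,
    smul_eq_mul, hB y x] at hle
  nlinarith [sq_nonneg (B x y - t * B x x)]

theorem eq_zero_of_forall_small {a b : ℝ} (h : ∀ ε : ℝ, ε * a + ε ^ 2 * b ≤ 0) : a = 0 := by
  by_contra ha
  -- With this choice the expression equals `ε² (|b| + 1 + b)`, which is positive unless `ε = 0`.
  set ε := a / (|b| + 1)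
  have hb : 0 < |b| + 1 := by positivity
  have h1 := h ε
  have h2 : a = ε * (|b| + 1) := by simp only [ε]; field_simp
  have hε : ε ≠ 0 := div_ne_zero ha hb.ne'
  have h3 : ε ^ 2 * (|b| + 1 + b) ≤ 0 := by
    calc ε ^ 2 * (|b| + 1 + b) = ε * a + ε ^ 2 * b := by rw [h2]; ring
      _ ≤ 0 := h1
  have h4 : 0 < |b| + 1 + b := by linarith [neg_abs_le b]
  have : 0 < ε ^ 2 * (|b| + 1 + b) := by positivity
  linarith

/-- If `B x x > 0`, the inequality for `x` and `v + ε y` has no constant term, so its linear term `2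
ε B x x B v y` must vanish; `y` being arbitrary, `B v = 0`. -/
theorem IsReverseCauchySchwarz.nonpos_of_orthogonal {B : V →L[ℝ] V →L[ℝ] ℝ}
    (hR : IsReverseCauchySchwarz B) (hB : ∀ x y, B x y = B y x) {v : V} (hv : B v ≠ 0)
    (hvv : B v v = 0) {x : V} (hx : B v x = 0) : B x x ≤ 0 := by
  by_contra! hpos
  refine hv (ContinuousLinearMap.ext fun y => ?_)
  have h := fun ε : ℝ => hR x (v + ε • y) hpos
  simp only [map_add, map_smul, add_apply, smul_apply,
    smul_eq_mul, hB y v, hB x v, hx, hvv] at h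
  have := eq_zero_of_forall_small (a := 2 * B x x * B v y)
    (b := B x x * B y y - B x y ^ 2) fun ε => by linarith [h ε]
  simpa [hpos.ne'] using this

/-- The form is nonpositive on the orthogonal of `v`, so a null `x` there is a maximum and is
orthogonal to that whole hyperplane. Thus `B x` is a multiple of `B v`, and nondegeneracy concludes.
-/
theorem IsReverseCauchySchwarz.mem_span_of_orthogonal {B : V →L[ℝ] V →L[ℝ] ℝ}
    (hR : IsReverseCauchySchwarz B) (hB : ∀ x y, B x y = B y x) (hnd : ∀ u, B u = 0 → u = 0)
    {v : V} (hv : B v ≠ 0) (hvv : B v v = 0) {x : V} (hx : B v x = 0) (hxx : B x x = 0) :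
    x ∈ Submodule.span ℝ {v} := by
  obtain ⟨c, hc⟩ := exists_smul_of_ker_le (B v) (B x) hv fun y hy => by
    have h := fun ε : ℝ => hR.nonpos_of_orthogonal hB hv hvv (x := x + ε • y) (by simp [hx, hy])
    simp only [map_add, map_smul, add_apply, smul_apply, smul_eq_mul, hB y x, hxx] at h
    have := eq_zero_of_forall_small (a := 2 * B x y) (b := B y y) fun ε => by linarith [h ε]
    linarith
  refine Submodule.mem_span_singleton.mpr ⟨c, ?_⟩
  have := hnd (x - c • v) (by rw [map_sub, map_smul, hc, sub_self])
  exact (sub_eq_zero.mp this).symm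

/-- The premise `0 < B x x` is open and the conclusion closed, so the inequality survives limits;
this carries the signature information to boundary points. -/
theorem isReverseCauchySchwarz_of_mem_closure {X : Type*} [TopologicalSpace X]
    {b : X → V →L[ℝ] V →L[ℝ] ℝ} {v : X} {A : Set X} (hv : v ∈ closure A) (hb : ContinuousAt b v)
    (h : ∀ᶠ x in 𝓝 v, x ∈ A → IsReverseCauchySchwarz (b x)) : IsReverseCauchySchwarz (b v) := by
  intro x y hxy
  have hc : ∀ u w, ContinuousAt (fun z => b z u w) v := fun u w =>
    (hb.clm_apply continuousAt_const).clm_apply continuousAt_const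
  have : (𝓝[A] v).NeBot := mem_closure_iff_nhdsWithin_neBot.mp hv
  refine le_of_tendsto_of_tendsto
    (((hc x x).mul (hc y y)).mono_left (nhdsWithin_le_nhds (s := A)))
    (((hc x y).pow 2).mono_left nhdsWithin_le_nhds) ?_
  rw [EventuallyLE, eventually_nhdsWithin_iff]
  filter_upwards [h, (hc x x).eventually (lt_mem_nhds hxy)] with z h1 h2 hz using h1 hz x y h2

end Lorentz

/-! ### Homogeneity and concavity along segments -/

section Norms

variable {V : Type*} [NormedAddCommGroup V] [NormedSpace ℝ V]

namespace IsPseudoMinkowskiNorm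

variable {k : ℕ∞} {A : Set V} {L : V → ℝ}

theorem contDiffAt (h : IsPseudoMinkowskiNorm k A L) (hk : 2 ≤ k) {x : V} (hx : x ∈ A) :
    ContDiffAt ℝ 2 L x :=
  (h.contDiffOn.contDiffAt (h.isOpen.mem_nhds hx)).of_le (by exact WithTop.coe_le_coe.mpr hk)

theorem fderiv_smul (h : IsPseudoMinkowskiNorm k A L) (hk : 2 ≤ k) {x : V} (hx : x ∈ A) {r : ℝ}
    (hr : 0 < r) : fderiv ℝ L (r • x) = r • fderiv ℝ L x := by
  have h1 : HasFDerivAt L (fderiv ℝ L (r • x)) (r • x) :=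
    ((h.contDiffAt hk (h.conic x hx r hr)).differentiableAt (by norm_num)).hasFDerivAt
  have h2 : HasFDerivAt L (fderiv ℝ L x) x :=
    ((h.contDiffAt hk hx).differentiableAt (by norm_num)).hasFDerivAt
  have h3 := h1.comp x ((hasFDerivAt_id x).const_smul r)
  have h4 : HasFDerivAt (fun y => L (r • y)) (r ^ 2 • fderiv ℝ L x) x := by
    refine (h2.const_smul (r ^ 2)).congr_of_eventuallyEq ?_
    filter_upwards [h.isOpen.mem_nhds hx] with y hy using h.homogeneous y hy r hr
  have h5 := h3.unique h4
  ext y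
  have h6 := DFunLike.congr_fun h5 y
  simp only [ContinuousLinearMap.comp_apply, smul_apply, ContinuousLinearMap.id_apply, map_smul,
    smul_eq_mul] at h6 ⊢
  have : r * (fderiv ℝ L (r • x) y - r * fderiv ℝ L x y) = 0 := by linear_combination h6
  rcases mul_eq_zero.mp this with h0 | h0
  · exact absurd h0 hr.ne'
  · linarith

theorem hasDerivAt_smul (x : V) : HasDerivAt (fun r : ℝ => r • x) x 1 := by
  simpa using (hasDerivAt_id (1 : ℝ)).smul_const x

/-- Euler's theorem for `L`. -/
theorem fderiv_self (h : IsPseudoMinkowskiNorm k A L) (hk : 2 ≤ k) {x : V} (hx : x ∈ A) :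
    fderiv ℝ L x x = 2 * L x := by
  have h2 : HasFDerivAt L (fderiv ℝ L x) ((1 : ℝ) • x) := by
    rw [one_smul]
    exact ((h.contDiffAt hk hx).differentiableAt (by norm_num)).hasFDerivAt
  have h3 := h2.comp_hasDerivAt 1 (hasDerivAt_smul x)
  have h4 : HasDerivAt (L ∘ fun r : ℝ => r • x) (2 * L x) 1 := by
    have : HasDerivAt (fun r : ℝ => r ^ 2 * L x) (2 * L x) 1 := by
      simpa using (hasDerivAt_pow 2 (1 : ℝ)).mul_const (L x)
    refine this.congr_of_eventuallyEq ?_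
    filter_upwards [lt_mem_nhds one_pos] with r hr using h.homogeneous x hx r hr
  exact h3.unique h4

/-- Euler's theorem for the differential of `L`. -/
theorem fderiv_fderiv_self (h : IsPseudoMinkowskiNorm k A L) (hk : 2 ≤ k) {x : V} (hx : x ∈ A) :
    fderiv ℝ (fderiv ℝ L) x x = fderiv ℝ L x := by
  have h2 : HasFDerivAt (fderiv ℝ L) (fderiv ℝ (fderiv ℝ L) x) ((1 : ℝ) • x) := by
    rw [one_smul]
    exact (h.contDiffAt hk hx).hasFDerivAt_fderiv
  have h3 := h2.comp_hasDerivAt 1 (hasDerivAt_smul x)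
  have h4 : HasDerivAt (fderiv ℝ L ∘ fun r : ℝ => r • x) (fderiv ℝ L x) 1 := by
    have : HasDerivAt (fun r : ℝ => r • fderiv ℝ L x) (fderiv ℝ L x) 1 := by
      simpa using (hasDerivAt_id (1 : ℝ)).smul_const (fderiv ℝ L x)
    refine this.congr_of_eventuallyEq ?_
    filter_upwards [lt_mem_nhds one_pos] with r hr using h.fderiv_smul hk hx hr
  exact h3.unique h4

end IsPseudoMinkowskiNorm

namespace IsLorentzMinkowskiNorm

variable [FiniteDimensional ℝ V] {k : ℕ∞} {A : Set V} {L : V → ℝ}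

theorem isReverseCauchySchwarz (h : IsLorentzMinkowskiNorm k A L) (hk : 2 ≤ k) {x : V}
    (hx : x ∈ A) : IsReverseCauchySchwarz (fderiv ℝ (fderiv ℝ L) x) := by
  obtain ⟨⟨W, hW, hdim⟩, -⟩ := h.index x hx
  refine isReverseCauchySchwarz_of_isNegDefOn (h.contDiffAt hk hx).fderiv_fderiv_comm (W := W)
    (fun w hw hw0 => ?_) (by omega)
  have := hW w hw hw0
  simp only [fundamentalTensor] at this
  linarith

/-- This is reverse Cauchy-Schwarz for the pair `x`, `w`, rewritten by Euler's identities. -/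
theorem two_mul_fderiv_fderiv_le (h : IsLorentzMinkowskiNorm k A L) (hk : 2 ≤ k) {x : V}
    (hx : x ∈ A) (w : V) :
    2 * L x * fderiv ℝ (fderiv ℝ L) x w w ≤ fderiv ℝ L x w ^ 2 := by
  have h1 := h.isReverseCauchySchwarz hk hx x w
  rw [h.fderiv_fderiv_self hk hx, h.fderiv_self hk hx] at h1
  exact h1 (mul_pos two_pos (h.pos x hx))

theorem concaveOn_sqrt_lineMap (h : IsLorentzMinkowskiNorm k A L) (hk : 2 ≤ k) (x y : V)
    {D : Set ℝ} (hD : Convex ℝ D) (hA : ∀ t ∈ D, x + t • y ∈ A) :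
    ConcaveOn ℝ D fun t => √(L (x + t • y)) := by
  have hc : ∀ t : ℝ, HasDerivAt (fun t : ℝ => x + t • y) y t := fun t => by
    have := ((hasDerivAt_id t).smul_const y).const_add x
    rwa [one_smul] at this
  refine concaveOn_sqrt_of_deriv hD (h' := fun t => fderiv ℝ L (x + t • y) y)
    (h'' := fun t => fderiv ℝ (fderiv ℝ L) (x + t • y) y y) (fun t ht => ?_) (fun t ht => ?_)
    (fun t ht => h.pos _ (hA t ht)) fun t ht => h.two_mul_fderiv_fderiv_le hk (hA t ht) y
  · exact ((h.contDiffAt hk (hA t ht)).differentiableAt (by norm_num)).hasFDerivAt.comp_hasDerivAt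
      t (hc t)
  · have h1 : HasDerivAt (fun t : ℝ => fderiv ℝ L (x + t • y))
        (fderiv ℝ (fderiv ℝ L) (x + t • y) y) t :=
      (h.contDiffAt hk (hA t ht)).hasFDerivAt_fderiv.comp_hasDerivAt t (hc t)
    have h2 := h1.clm_apply (hasDerivAt_const t y)
    rwa [map_zero, add_zero] at h2

end IsLorentzMinkowskiNorm

end Norms

/-! ### Convexity from connectedness; conic sets -/

section Convexity

variable {V : Type*} [NormedAddCommGroup V] [NormedSpace ℝ V]

/-- A connected open set is convex if a continuous function, positive exactly on it, is
quasiconcave along the segments that it contains. -/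
theorem convex_of_quasiconcave_on_segments {A : Set V} (hA : IsOpen A) (hc : IsPreconnected A)
    {F : V → ℝ} (hF : Continuous F) (hpos : ∀ x, 0 < F x ↔ x ∈ A)
    (hq : ∀ x y, (∀ t ∈ Icc (0 : ℝ) 1, x + t • (y - x) ∈ A) →
      ∀ t ∈ Icc (0 : ℝ) 1, min (F x) (F y) ≤ F (x + t • (y - x))) : Convex ℝ A := by
  rw [convex_iff_segment_subset]
  intro x hx y hy
  -- The points seen from `x` within `A`: an open set by compactness of `[0, 1]`, and relatively
  -- closed in `A` because the positive lower bound `min (F x) (F z)` persists in the limit.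
  let S : Set V := {y | ∀ t ∈ Icc (0 : ℝ) 1, x + t • (y - x) ∈ A}
  have hcont : Continuous fun p : V × ℝ => x + p.2 • (p.1 - x) := by fun_prop
  have hS : IsOpen S := by
    rw [isOpen_iff_mem_nhds]
    intro z hz
    exact isCompact_Icc.eventually_forall_of_forall_eventually fun t ht =>
      (hcont.tendsto (z, t)).eventually (hA.mem_nhds (hz t ht))
  have hxS : x ∈ S := fun t _ => by simpa using hx
  have hcl : closure S ∩ A ⊆ S := by
    rintro z ⟨hz, hzA⟩ t ht
    rw [← hpos]
    refine lt_of_lt_of_le (lt_min ((hpos x).mpr hx) ((hpos z).mpr hzA)) ?_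
    have hclosed : IsClosed {z | min (F x) (F z) ≤ F (x + t • (z - x))} :=
      isClosed_le (by fun_prop) (by fun_prop)
    exact closure_minimal (fun w hw => hq x w hw t ht) hclosed hz
  have hyS : y ∈ S := hc.subset_of_closure_inter_subset hS ⟨x, hx, hxS⟩ hcl hy
  rw [segment_eq_image']
  rintro _ ⟨t, ht, rfl⟩
  exact hyS t ht

theorem IsConic.smul_mem_iff {A : Set V} (h : IsConic A) {r : ℝ} (hr : 0 < r) {x : V} :
    r • x ∈ A ↔ x ∈ A := by
  refine ⟨fun hx => ?_, fun hx => h x hx r hr⟩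
  have := h _ hx r⁻¹ (inv_pos.mpr hr)
  rwa [inv_smul_smul₀ hr.ne'] at this

theorem IsConic.puncturedBoundary {A : Set V} (h : IsConic A) : IsConic (puncturedBoundary A) := by
  rintro v ⟨hv, hv0⟩ r hr
  refine ⟨?_, by simpa [hr.ne'] using hv0⟩
  have h1 : (Homeomorph.smulOfNeZero r hr.ne' : V ≃ₜ V) ⁻¹' A = A := by
    ext x
    exact h.smul_mem_iff hr
  have h2 := (Homeomorph.smulOfNeZero r hr.ne' : V ≃ₜ V).preimage_frontier A
  rw [h1] at h2
  rw [← h2] at hv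
  exact hv

/-- An open convex conic set absorbs the addition of vectors of its closure. -/
theorem IsConic.add_smul_mem {A : Set V} (h : IsConic A) (hA : IsOpen A) (hc : Convex ℝ A) {a v : V}
    (ha : a ∈ A) (hv : v ∈ closure A) {t : ℝ} (ht : 0 < t) : a + t • v ∈ A := by
  have h1 := hc.openSegment_interior_closure_subset_interior (hA.interior_eq.symm ▸ ha) hv
  have h2 : (1 / (1 + t)) • a + (t / (1 + t)) • v ∈ A := by
    refine interior_subset (h1 ⟨1 / (1 + t), t / (1 + t), by positivity, by positivity, ?_, rfl⟩)
    field_simp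
  have h3 := h _ h2 (1 + t) (by positivity)
  rw [smul_add, smul_smul, smul_smul, mul_div_cancel₀ _ (by positivity),
    mul_div_cancel₀ _ (by positivity), one_smul] at h3
  exact h3

end Convexity

/-! ### The boundary of a properly Lorentz-Minkowski norm -/

/-- `f` extends `L : A → (0, ∞)` near the boundary point `v` as a function of class `C²`, by zero on
the boundary, and its second differential at `v` is a Lorentzian form. -/
structure IsLorentzExtension {V : Type*} [NormedAddCommGroup V] [NormedSpace ℝ V] (A : Set V)
    (L : V → ℝ) (v : V) (f : V → ℝ) : Prop where
  contDiffAt : ContDiffAt ℝ 2 f v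
  eventually_eq : ∀ᶠ x in 𝓝 v, x ∈ A → f x = L x
  eventually_zero : ∀ᶠ x in 𝓝 v, x ∈ puncturedBoundary A → f x = 0
  apply_eq_zero : f v = 0
  fderiv_fderiv_self : fderiv ℝ (fderiv ℝ f) v v = fderiv ℝ f v
  fderiv_self : fderiv ℝ f v v = 0
  fderiv_ne_zero : fderiv ℝ f v ≠ 0
  nondegenerate : ∀ u, fderiv ℝ (fderiv ℝ f) v u = 0 → u = 0
  reverse : IsReverseCauchySchwarz (fderiv ℝ (fderiv ℝ f) v)

section Norms

variable {V : Type*} [NormedAddCommGroup V] [NormedSpace ℝ V] [FiniteDimensional ℝ V] {k : ℕ∞}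
  {A : Set V} {L : V → ℝ}

namespace IsProperlyLorentzMinkowskiNorm

theorem exists_isLorentzExtension (h : IsProperlyLorentzMinkowskiNorm k A L) (hk : 2 ≤ k) {v : V}
    (hv : v ∈ puncturedBoundary A) : ∃ f, IsLorentzExtension A L v f := by
  obtain ⟨U, f, hU, hvU, hf, hfL, hf0, hnd⟩ := h.extends_zero v hv
  have hP := h.toIsPseudoMinkowskiNorm
  have hcl : v ∈ closure A := frontier_subset_closure hv.1
  have hf2 : ContDiffAt ℝ 2 f v :=
    (hf.contDiffAt (hU.mem_nhds hvU)).of_le (by exact WithTop.coe_le_coe.mpr hk)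
  have hfv : f v = 0 := hf0 v ⟨hv, hvU⟩
  have heq : ∀ᶠ x in 𝓝 v, x ∈ A → f =ᶠ[𝓝 x] L := by
    filter_upwards [hU.mem_nhds hvU] with x hx hxA
    filter_upwards [hU.mem_nhds hx, h.isOpen.mem_nhds hxA] with y h1 h2 using hfL y ⟨h2, h1⟩
  have hne : (𝓝[A] v).NeBot := mem_closure_iff_nhdsWithin_neBot.mp hcl
  have hc1 : ContinuousAt (fderiv ℝ f) v := hf2.hasFDerivAt_fderiv.continuousAt
  have hc2 := hf2.continuousAt_fderiv_fderiv
  have hdd : fderiv ℝ (fderiv ℝ f) v v = fderiv ℝ f v := by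
    refine tendsto_nhds_unique_of_eventuallyEq
      ((hc2.clm_apply continuousAt_id).mono_left (nhdsWithin_le_nhds (s := A)))
      (hc1.mono_left nhdsWithin_le_nhds) ?_
    rw [EventuallyEq, eventually_nhdsWithin_iff]
    filter_upwards [heq] with x hx hxA
    rw [(hx hxA).fderiv.fderiv_eq, (hx hxA).fderiv_eq]
    exact hP.fderiv_fderiv_self hk hxA
  have hd : fderiv ℝ f v v = 2 * f v := by
    refine tendsto_nhds_unique_of_eventuallyEq
      ((hc1.clm_apply continuousAt_id).mono_left (nhdsWithin_le_nhds (s := A)))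
      ((hf2.continuousAt.const_mul 2).mono_left nhdsWithin_le_nhds) ?_
    rw [EventuallyEq, eventually_nhdsWithin_iff]
    filter_upwards [heq] with x hx hxA
    rw [(hx hxA).fderiv_eq, (hx hxA).eq_of_nhds]
    exact hP.fderiv_self hk hxA
  have hnd' : ∀ u, fderiv ℝ (fderiv ℝ f) v u = 0 → u = 0 := fun u hu =>
    hnd u fun w => by simp [fundamentalTensor, hu]
  refine ⟨f, hf2, heq.mono fun x hx hxA => (hx hxA).eq_of_nhds, ?_, hfv, hdd, by simp [hd, hfv],
    fun h0 => hv.2 (hnd' v (hdd.trans h0)), hnd', ?_⟩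
  · filter_upwards [hU.mem_nhds hvU] with x hx hxA using hf0 x ⟨hxA, hx⟩
  · refine isReverseCauchySchwarz_of_mem_closure hcl hc2 ?_
    filter_upwards [heq] with x hx hxA
    rw [(hx hxA).fderiv.fderiv_eq]
    exact h.isReverseCauchySchwarz hk hxA

/-- Off the origin this is the zero extension; at the origin, homogeneity and a bound `K` on the
unit sphere give `K ‖y‖²`. -/
theorem continuous_indicator (h : IsProperlyLorentzMinkowskiNorm k A L) (hk : 2 ≤ k) :
    Continuous (A.indicator L) := by
  have hne : ∀ x, x ≠ 0 → ContinuousAt (A.indicator L) x := by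
    intro x hx
    by_cases hxA : x ∈ A
    · refine (h.contDiffAt hk hxA).continuousAt.congr ?_
      filter_upwards [h.isOpen.mem_nhds hxA] with y hy using (indicator_of_mem hy L).symm
    by_cases hxc : x ∈ closure A
    · obtain ⟨f, hf⟩ := h.exists_isLorentzExtension hk (v := x)
        ⟨⟨hxc, by rwa [h.isOpen.interior_eq]⟩, hx⟩
      rw [ContinuousAt, indicator_of_notMem hxA]
      have h1 : Tendsto (fun y => ‖f y‖) (𝓝 x) (𝓝 0) := by
        have := hf.contDiffAt.continuousAt.norm
        rwa [ContinuousAt, hf.apply_eq_zero, norm_zero] at this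
      refine squeeze_zero_norm' ?_ h1
      filter_upwards [hf.eventually_eq] with y hy
      by_cases hyA : y ∈ A
      · rw [indicator_of_mem hyA, hy hyA]
      · simp [indicator_of_notMem hyA]
    · refine (continuousAt_const (y := (0 : ℝ))).congr ?_
      filter_upwards [isClosed_closure.isOpen_compl.mem_nhds hxc] with y hy
      exact (indicator_of_notMem (fun hyA => hy (subset_closure hyA)) L).symm
  have hhom : ∀ y (r : ℝ), 0 < r → A.indicator L (r • y) = r ^ 2 * A.indicator L y := by
    intro y r hr
    by_cases hy : y ∈ A
    · rw [indicator_of_mem hy, indicator_of_mem (h.conic y hy r hr), h.homogeneous y hy r hr]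
    · rw [indicator_of_notMem hy, indicator_of_notMem (by rwa [h.conic.smul_mem_iff hr]), mul_zero]
  rw [continuous_iff_continuousAt]
  intro x
  rcases ne_or_eq x 0 with hx | rfl
  · exact hne x hx
  have : ProperSpace V := FiniteDimensional.proper ℝ V
  obtain ⟨K, hK⟩ := (isCompact_sphere (0 : V) 1).exists_bound_of_continuousOn
    (f := A.indicator L) fun y hy => (hne y (ne_zero_of_mem_unit_sphere ⟨y, hy⟩)).continuousWithinAt
  have h0 : A.indicator L 0 = 0 := indicator_of_notMem h.zero_notMem L
  have hbound : ∀ y, ‖A.indicator L y‖ ≤ K * ‖y‖ ^ 2 := by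
    intro y
    rcases eq_or_ne y 0 with rfl | hy
    · simp [h0]
    have hy' : 0 < ‖y‖ := norm_pos_iff.mpr hy
    have h1 := hhom (‖y‖⁻¹ • y) ‖y‖ hy'
    rw [smul_inv_smul₀ hy'.ne'] at h1
    have h2 := hK (‖y‖⁻¹ • y) (by simp [norm_smul, hy'.ne'])
    rw [h1, norm_mul, norm_pow, norm_norm, mul_comm]
    gcongr
  rw [ContinuousAt, h0]
  refine squeeze_zero_norm hbound ?_
  have : Continuous fun y : V => K * ‖y‖ ^ 2 := by fun_prop
  simpa using this.tendsto 0

theorem convex (h : IsProperlyLorentzMinkowskiNorm k A L) (hk : 2 ≤ k) : Convex ℝ A := by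
  refine convex_of_quasiconcave_on_segments h.isOpen h.connected.isPreconnected
    (h.continuous_indicator hk).sqrt (fun x => ?_) fun x y hxy t ht => ?_
  · rw [Real.sqrt_pos]
    by_cases hx : x ∈ A
    · simp [hx, h.pos x hx]
    · simp [hx]
  · have hc := h.concaveOn_sqrt_lineMap hk x (y - x) (convex_Icc 0 1) hxy
    have h1 := hc.min_le_of_mem_Icc (left_mem_Icc.mpr zero_le_one) (right_mem_Icc.mpr zero_le_one) ht
    have hx : x ∈ A := by simpa using hxy 0 (left_mem_Icc.mpr zero_le_one)
    have hy : y ∈ A := by simpa using hxy 1 (right_mem_Icc.mpr zero_le_one)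
    simpa [indicator_of_mem, hx, hy, hxy t ht] using h1

theorem concaveOn_sqrt (h : IsProperlyLorentzMinkowskiNorm k A L) (hk : 2 ≤ k) :
    ConcaveOn ℝ A fun x => √(L x) := by
  refine ⟨h.convex hk, fun x hx y hy a b ha hb hab => ?_⟩
  have hc := h.concaveOn_sqrt_lineMap hk x (y - x) (convex_Icc 0 1) fun t ht =>
    (h.convex hk).add_smul_sub_mem hx hy ht
  have h1 := hc.2 (left_mem_Icc.mpr zero_le_one) (right_mem_Icc.mpr zero_le_one) ha hb hab
  have h2 : a • x + b • y = x + b • (y - x) := by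
    rw [← eq_sub_iff_add_eq] at hab
    rw [hab]; module
  rw [h2]
  simpa using h1

/-- Otherwise `A` is all of `V ∖ {0}`, which is connected as `n ≥ 2`; then the midpoint of `a` and
`-a` contradicts convexity. -/
theorem puncturedBoundary_nonempty (h : IsProperlyLorentzMinkowskiNorm k A L) (hk : 2 ≤ k)
    (hdim : 2 ≤ finrank ℝ V) : (puncturedBoundary A).Nonempty := by
  by_contra hempty
  rw [not_nonempty_iff_eq_empty] at hempty
  have hconn := (isConnected_compl_singleton_of_one_lt_rank (E := V)
    (by rw [← finrank_eq_rank]; exact_mod_cast hdim) 0).isPreconnected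
  obtain ⟨a, ha⟩ := h.nonempty
  have ha0 : ∀ {x}, x ∈ A → x ≠ 0 := fun hx h0 => h.zero_notMem (h0 ▸ hx)
  have hsub := hconn.subset_of_closure_inter_subset h.isOpen ⟨a, ha0 ha, ha⟩ (by
    rintro x ⟨hx, hx0⟩
    by_contra hxA
    exact hempty.subset ⟨⟨hx, by rwa [h.isOpen.interior_eq]⟩, hx0⟩)
  have hna : -a ∈ A := hsub (neg_ne_zero.mpr (ha0 ha))
  have := h.convex hk ha hna (a := 1 / 2) (b := 1 / 2) (by norm_num) (by norm_num) (by norm_num)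
  rw [smul_neg, add_neg_cancel] at this
  exact h.zero_notMem this

theorem salient (h : IsProperlyLorentzMinkowskiNorm k A L) (hk : 2 ≤ k) {v : V}
    (hv : v ∈ puncturedBoundary A) : -v ∉ puncturedBoundary A := by
  intro hnv
  obtain ⟨f, hf⟩ := h.exists_isLorentzExtension hk hv
  have hmem : ∀ a ∈ A, ∀ t : ℝ, 0 < t → a + t • v ∈ A ∧ a + t • -v ∈ A := fun a ha t ht =>
    ⟨h.conic.add_smul_mem h.isOpen (h.convex hk) ha (frontier_subset_closure hv.1) ht,
      h.conic.add_smul_mem h.isOpen (h.convex hk) ha (frontier_subset_closure hnv.1) ht⟩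
  -- `a` is the midpoint of `a + t v` and `a - t v`; concavity of `√L` gives a factor 2, squared
  -- here.
  have hbound : ∀ a ∈ A, ∀ t : ℝ, 0 < t → L (a + t • v) ≤ 4 * L a := by
    intro a ha t ht
    obtain ⟨h1, h2⟩ := hmem a ha t ht
    have h3 := (h.concaveOn_sqrt hk).2 h1 h2 (by norm_num : (0 : ℝ) ≤ 1 / 2)
      (by norm_num : (0 : ℝ) ≤ 1 / 2) (by norm_num)
    have h4 : (1 / 2 : ℝ) • (a + t • v) + (1 / 2 : ℝ) • (a + t • -v) = a := by module
    rw [h4] at h3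
    simp only [smul_eq_mul] at h3
    have h5 : √(L (a + t • v)) ≤ 2 * √(L a) := by linarith [Real.sqrt_nonneg (L (a + t • -v))]
    calc L (a + t • v) = √(L (a + t • v)) ^ 2 := (Real.sq_sqrt (h.pos _ h1).le).symm
      _ ≤ (2 * √(L a)) ^ 2 := by gcongr
      _ = 4 * L a := by rw [mul_pow, Real.sq_sqrt (h.pos _ ha).le]; norm_num
  have hzero : ∀ a ∈ A, fderiv ℝ f v a = 0 := by
    intro a ha
    have hc : HasDerivAt (fun s : ℝ => v + s • a) a 0 := by
      have := ((hasDerivAt_id (0 : ℝ)).smul_const a).const_add v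
      rwa [one_smul] at this
    have hfd : HasFDerivAt f (fderiv ℝ f v) (v + (0 : ℝ) • a) := by
      rw [zero_smul, add_zero]
      exact (hf.contDiffAt.differentiableAt (by norm_num)).hasFDerivAt
    have h1 : HasDerivAt (fun s : ℝ => f (v + s • a)) (fderiv ℝ f v a) 0 :=
      hfd.comp_hasDerivAt 0 hc
    have h2 := h1.tendsto_slope_zero_right
    simp only [zero_add, zero_smul, add_zero, hf.apply_eq_zero, sub_zero, smul_eq_mul] at h2
    have hev : ∀ᶠ s in 𝓝[>] (0 : ℝ), 0 ≤ s⁻¹ * f (v + s • a) ∧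
        s⁻¹ * f (v + s • a) ≤ s * (4 * L a) := by
      have htend : Tendsto (fun s : ℝ => v + s • a) (𝓝 0) (𝓝 v) := by
        simpa using hc.continuousAt.tendsto
      filter_upwards [(htend.eventually hf.eventually_eq).filter_mono nhdsWithin_le_nhds,
        self_mem_nhdsWithin] with s hs hs0
      have hs0 : 0 < s := hs0
      have hm := (hmem a ha s⁻¹ (inv_pos.mpr hs0)).1
      -- By homogeneity `L (v + s a) = s² L (a + s⁻¹ v) ≤ 4 s² L a`, so the one-sided derivative at
      -- `s = 0` vanishes.
      have he : s • (a + s⁻¹ • v) = v + s • a := by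
        rw [smul_add, smul_inv_smul₀ hs0.ne', add_comm]
      have hm' : v + s • a ∈ A := he ▸ h.conic _ hm s hs0
      have hL := h.homogeneous _ hm s hs0
      rw [he] at hL
      rw [hs hm']
      refine ⟨mul_nonneg (inv_nonneg.mpr hs0.le) (h.pos _ hm').le, ?_⟩
      rw [hL, inv_mul_le_iff₀ hs0]
      calc s ^ 2 * L (a + s⁻¹ • v) ≤ s ^ 2 * (4 * L a) := by
            gcongr; exact hbound a ha _ (inv_pos.mpr hs0)
        _ = s * (s * (4 * L a)) := by ring
    refine tendsto_nhds_unique h2 (squeeze_zero' (g := fun s : ℝ => s * (4 * L a))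
      (hev.mono fun _ h => h.1) (hev.mono fun _ h => h.2) ?_)
    have : Continuous fun s : ℝ => s * (4 * L a) := by fun_prop
    simpa using (this.tendsto 0).mono_left nhdsWithin_le_nhds
  obtain ⟨a, ha⟩ := h.nonempty
  refine hf.fderiv_ne_zero (ContinuousLinearMap.ext fun x => ?_)
  have hc : Tendsto (fun t : ℝ => a + t • x) (𝓝 0) (𝓝 a) := by
    have : Continuous fun t : ℝ => a + t • x := by fun_prop
    simpa using this.tendsto 0
  obtain ⟨t, ht, ht0⟩ := (((hc.eventually (h.isOpen.mem_nhds ha)).filter_mono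
    nhdsWithin_le_nhds).and (self_mem_nhdsWithin (s := {(0 : ℝ)}ᶜ))).exists
  have h1 := hzero _ ht
  rw [map_add, hzero a ha, zero_add, map_smul, smul_eq_mul] at h1
  exact (mul_eq_zero.mp h1).resolve_left ht0

theorem isNonRadiallyStronglyConvex (h : IsProperlyLorentzMinkowskiNorm k A L) (hk : 2 ≤ k) :
    IsNonRadiallyStronglyConvex (puncturedBoundary A) A := by
  intro v hv U φ hφ N hN hφN
  obtain ⟨f, hf⟩ := h.exists_isLorentzExtension hk hv
  have hφ2 : ContDiffAt ℝ 2 φ v := hφ.contDiffOn.contDiffAt (hφ.isOpen.mem_nhds hφ.mem)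
  have hφv : φ v = 0 := (hφ.inter_eq.subset ⟨hv, hφ.mem⟩).2
  obtain ⟨c, hc, hcc⟩ := exists_smul_of_zero_set_subset hφ2 hf.contDiffAt hφv hφ.fderiv_ne_zero (by
    filter_upwards [hf.eventually_zero, hφ.isOpen.mem_nhds hφ.mem] with x hx hxU hx0
    exact hx (hφ.inter_eq.superset ⟨hxU, hx0⟩).1)
  have hc0 : c ≠ 0 := by
    rintro rfl
    exact hf.fderiv_ne_zero (by rw [hc, zero_smul])
  have hker : ∀ X, fderiv ℝ φ v X = 0 ↔ fderiv ℝ f v X = 0 := fun X => by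
    rw [hc, smul_apply, smul_eq_mul, mul_eq_zero, or_iff_right hc0]
  -- `f = L > 0` along `v + t N` for small `t > 0`, and `f v = 0`.
  have hfN : 0 < fderiv ℝ f v N := by
    refine lt_of_le_of_ne ?_ fun h0 => hφN ((hker N).mpr h0.symm)
    obtain ⟨ε, hε, hεA⟩ := hN
    have hd : HasDerivAt (fun t : ℝ => v + t • N) N 0 := by
      have := ((hasDerivAt_id (0 : ℝ)).smul_const N).const_add v
      rwa [one_smul] at this
    have hfd : HasFDerivAt f (fderiv ℝ f v) (v + (0 : ℝ) • N) := by
      rw [zero_smul, add_zero]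
      exact (hf.contDiffAt.differentiableAt (by norm_num)).hasFDerivAt
    have h1 : HasDerivAt (fun s : ℝ => f (v + s • N)) (fderiv ℝ f v N) 0 :=
      hfd.comp_hasDerivAt 0 hd
    have h2 := h1.tendsto_slope_zero_right
    simp only [zero_add, zero_smul, add_zero, hf.apply_eq_zero, sub_zero, smul_eq_mul] at h2
    refine ge_of_tendsto h2 ?_
    have htend : Tendsto (fun s : ℝ => v + s • N) (𝓝 0) (𝓝 v) := by
      simpa using hd.continuousAt.tendsto
    filter_upwards [(htend.eventually hf.eventually_eq).filter_mono nhdsWithin_le_nhds,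
      Ioo_mem_nhdsGT hε] with s hs hsε
    have hm := hεA s hsε.1 hsε.2
    rw [hs hm]
    exact mul_nonneg (inv_nonneg.mpr hsε.1.le) (h.pos _ hm).le
  -- The factor `c` cancels in the quotient, so its sign is irrelevant and `f` may replace `φ`.
  have hσ : ∀ X Y, fderiv ℝ φ v X = 0 → fderiv ℝ φ v Y = 0 →
      secondFundamentalForm φ v N X Y =
        -(fderiv ℝ (fderiv ℝ f) v X Y) / fderiv ℝ f v N := by
    intro X Y hX hY
    rw [secondFundamentalForm, hcc X Y hX hY, hc, smul_apply, smul_eq_mul, neg_div, neg_div,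
      mul_div_mul_left _ _ hc0]
  have hsymm := hf.contDiffAt.fderiv_fderiv_comm
  have hv0 : fderiv ℝ (fderiv ℝ f) v v ≠ 0 := by
    rw [hf.fderiv_fderiv_self]; exact hf.fderiv_ne_zero
  have hvv : fderiv ℝ (fderiv ℝ f) v v v = 0 := by
    rw [hf.fderiv_fderiv_self]; exact hf.fderiv_self
  have horth : ∀ X, fderiv ℝ φ v X = 0 → fderiv ℝ (fderiv ℝ f) v v X = 0 := fun X hX => by
    rw [hf.fderiv_fderiv_self]; exact (hker X).mp hX
  refine ⟨fun X hX => ?_, fun X => ⟨?_, fun hX => ?_⟩⟩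
  · rw [hσ X X hX hX]
    exact div_nonneg (neg_nonneg.mpr (hf.reverse.nonpos_of_orthogonal hsymm hv0 hvv (horth X hX)))
      hfN.le
  · rintro ⟨hX, hrad⟩
    have h1 := hrad X hX
    rw [hσ X X hX hX, div_eq_zero_iff, or_iff_left hfN.ne', neg_eq_zero] at h1
    exact hf.reverse.mem_span_of_orthogonal hsymm hf.nondegenerate hv0 hvv (horth X hX) h1
  · obtain ⟨r, rfl⟩ := Submodule.mem_span_singleton.mp hX
    have hr : fderiv ℝ φ v (r • v) = 0 := by
      rw [hker, map_smul, hf.fderiv_self, smul_zero]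
    refine ⟨hr, fun Y hY => ?_⟩
    rw [hσ _ Y hr hY, map_smul, smul_apply, horth Y hY, smul_zero, neg_zero, zero_div]

/-- The boundary of the domain of a properly Lorentz-Minkowski norm is a strong cone. -/
theorem isStrongCone (h : IsProperlyLorentzMinkowskiNorm k A L) (hk : 2 ≤ k)
    (hdim : 2 ≤ finrank ℝ V) : IsStrongCone k (puncturedBoundary A) A where
  nonempty := h.puncturedBoundary_nonempty hk hdim
  zero_notMem h0 := h0.2 rfl
  hypersurface v hv := by
    obtain ⟨U, φ, hφ, -⟩ := h.smooth_boundary v hv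
    exact ⟨U, φ, hφ⟩
  conic := h.conic.puncturedBoundary
  salient _ hv := h.salient hk hv
  isOpen_interior := h.isOpen
  zero_notMem_interior := h.zero_notMem
  eq_boundary := rfl
  convex_interior := h.convex hk
  strongly_convex := h.isNonRadiallyStronglyConvex hk

end IsProperlyLorentzMinkowskiNorm

end Norms

/-! ### Kernels and differentials on manifolds -/

theorem ker_sup_ker_eq_top {F G : Type*} [AddCommGroup F] [Module ℝ F] [AddCommGroup G] [Module ℝ G]
    (P : F →ₗ[ℝ] G) (ℓ : F →ₗ[ℝ] ℝ) {ξ : F} (hP : P ξ = 0) (hℓ : ℓ ξ ≠ 0) :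
    LinearMap.ker P ⊔ LinearMap.ker ℓ = ⊤ := by
  refine eq_top_iff.mpr fun x _ => ?_
  rw [Submodule.mem_sup]
  exact ⟨(ℓ x / ℓ ξ) • ξ, by simp [hP], x - (ℓ x / ℓ ξ) • ξ, by simp [hℓ], by simp⟩

section Manifold

variable {F : Type*} [NormedAddCommGroup F] [NormedSpace ℝ F] {H : Type*} [TopologicalSpace H]
  {I : ModelWithCorners ℝ F H} [I.Boundaryless] {N : Type*} [TopologicalSpace N] [ChartedSpace H N]

theorem ContMDiffAt.contDiffAt_comp_extChartAt_symm {n : ℕ∞ω} {f : N → ℝ} {v : N}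
    (hf : ContMDiffAt I 𝓘(ℝ, ℝ) n f v) :
    ContDiffAt ℝ n (f ∘ (extChartAt I v).symm) (extChartAt I v v) := by
  have h := (contMDiffAt_iff.mp hf).2
  rw [I.range_eq_univ, contDiffWithinAt_univ] at h
  exact h

theorem MDifferentiableAt.mfderiv_eq_fderiv_comp_extChartAt_symm {f : N → ℝ} {v : N}
    (hf : MDifferentiableAt I 𝓘(ℝ, ℝ) f v) :
    mfderiv I 𝓘(ℝ, ℝ) f v = fderiv ℝ (f ∘ (extChartAt I v).symm) (extChartAt I v v) := by
  rw [hf.mfderiv, I.range_eq_univ, fderivWithin_univ]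
  rfl

/-- On a manifold, two functions, the first one regular and the second one vanishing where the first
one does: the kernel of the differential of the first one is contained in that of the second. -/
theorem mfderiv_eq_zero_of_zero_set_subset [CompleteSpace F] {φ f : N → ℝ} {v : N}
    (hφ : ContMDiffAt I 𝓘(ℝ, ℝ) 2 φ v) (hf : ContMDiffAt I 𝓘(ℝ, ℝ) 2 f v) (h0 : φ v = 0)
    (hd : mfderiv I 𝓘(ℝ, ℝ) φ v ≠ 0) (hz : ∀ᶠ x in 𝓝 v, φ x = 0 → f x = 0) :
    ∀ ξ, mfderiv I 𝓘(ℝ, ℝ) φ v ξ = 0 → mfderiv I 𝓘(ℝ, ℝ) f v ξ = 0 := by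
  rw [(hφ.mdifferentiableAt (by norm_num)).mfderiv_eq_fderiv_comp_extChartAt_symm] at hd ⊢
  rw [(hf.mdifferentiableAt (by norm_num)).mfderiv_eq_fderiv_comp_extChartAt_symm]
  have hsymm : Tendsto (extChartAt I v).symm (𝓝 (extChartAt I v v)) (𝓝 v) := by
    have := continuousAt_extChartAt_symm (I := I) v
    rwa [ContinuousAt, extChartAt_to_inv] at this
  obtain ⟨c, hc, -⟩ := exists_smul_of_zero_set_subset hφ.contDiffAt_comp_extChartAt_symm
    hf.contDiffAt_comp_extChartAt_symm (by simpa using h0) hd (hsymm.eventually hz)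
  intro ξ hξ
  rw [hc]
  exact (congrArg (c * ·) hξ).trans (mul_zero c)

end Manifold

/-! ### Fibres of the tangent bundle and contractions -/

section TangentBundle

variable {E : Type*} [NormedAddCommGroup E] [NormedSpace ℝ E]
  {M : Type*} [TopologicalSpace M] [ChartedSpace E M] [IsManifold 𝓘(ℝ, E) 1 M]

/-- The inclusion of the fibre `T_pM` in `TM`. -/
def fibreInclusion (E : Type*) [NormedAddCommGroup E] [NormedSpace ℝ E] {M : Type*}
    [TopologicalSpace M] [ChartedSpace E M] (p : M) (w : E) : TangentBundle 𝓘(ℝ, E) M :=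
  ⟨p, w⟩

theorem contMDiff_fibreInclusion (p : M) (n : ℕ∞ω) :
    ContMDiff 𝓘(ℝ, E) 𝓘(ℝ, E).tangent n (fibreInclusion E p) := by
  intro w
  refine (Bundle.contMDiffAt_totalSpace (f := fibreInclusion E p) (x₀ := w)).mpr
    ⟨contMDiffAt_const, ?_⟩
  simp only [fibreInclusion, TangentBundle.trivializationAt_apply]
  exact ContinuousLinearMap.contMDiffAt _

theorem continuous_fibreInclusion (p : M) : Continuous (fibreInclusion E p) :=
  (contMDiff_fibreInclusion p 0).continuous

theorem mfderiv_proj_mfderiv_fibreInclusion (p : M) (w X : E) :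
    mfderiv 𝓘(ℝ, E).tangent 𝓘(ℝ, E) (fun x : TangentBundle 𝓘(ℝ, E) M => x.proj)
      (fibreInclusion E p w) (mfderiv 𝓘(ℝ, E) 𝓘(ℝ, E).tangent (fibreInclusion E p) w X) = 0 := by
  have h1 : MDifferentiableAt 𝓘(ℝ, E).tangent 𝓘(ℝ, E)
      (fun x : TangentBundle 𝓘(ℝ, E) M => x.proj) (fibreInclusion E p w) :=
    (Bundle.contMDiffAt_proj (TangentSpace 𝓘(ℝ, E) : M → Type _) (n := 1)).mdifferentiableAt
      (by norm_num)
  have h2 := ((contMDiff_fibreInclusion (E := E) p 1) w).mdifferentiableAt (by norm_num)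
  have h3 := mfderiv_comp_apply w h1 h2 X
  rw [← h3]
  have : (fun x : TangentBundle 𝓘(ℝ, E) M => x.proj) ∘ fibreInclusion E p = fun _ => p := rfl
  rw [this, mfderiv_const]
  rfl

variable {k : ℕ∞} {A : Set (TangentBundle 𝓘(ℝ, E) M)} {L : TangentBundle 𝓘(ℝ, E) M → ℝ}

theorem isOpen_fibreAt (hA : IsOpen A) (p : M) : IsOpen (fibreAt A p) :=
  hA.preimage (continuous_fibreInclusion p)

theorem puncturedBoundary_fibreAt_subset (hA : IsOpen A) (p : M) :
    puncturedBoundary (fibreAt A p) ⊆ fibreAt (tangentBoundary A) p := by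
  rintro w ⟨hw, hw0⟩
  refine ⟨⟨?_, ?_⟩, hw0⟩
  · exact (continuous_fibreInclusion p).closure_preimage_subset A (frontier_subset_closure hw)
  · rw [hA.interior_eq]
    have := hw.2
    rwa [(isOpen_fibreAt hA p).interior_eq] at this

/-- Contraction with ratio `t` of the fibres of `TM` near `p` towards a local vector field that
extends the tangent vector `a` at `p`. -/
noncomputable def fibreContraction (p : M) (a : E) (t : ℝ) (x : TangentBundle 𝓘(ℝ, E) M) :
    TangentBundle 𝓘(ℝ, E) M :=
  ⟨x.proj, (1 - t) • (trivializationAt E (TangentSpace 𝓘(ℝ, E)) p).symmL ℝ x.proj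
    (trivializationAt E (TangentSpace 𝓘(ℝ, E)) p (fibreInclusion E p a)).2 + t • x.2⟩

theorem trivializationAt_fibreContraction (p : M) (a : E) (t : ℝ)
    {x : TangentBundle 𝓘(ℝ, E) M}
    (hx : x.proj ∈ (trivializationAt E (TangentSpace 𝓘(ℝ, E)) p).baseSet) :
    (trivializationAt E (TangentSpace 𝓘(ℝ, E)) p (fibreContraction p a t x)).2 =
      (1 - t) • (trivializationAt E (TangentSpace 𝓘(ℝ, E)) p (fibreInclusion E p a)).2 +
        t • (trivializationAt E (TangentSpace 𝓘(ℝ, E)) p x).2 := by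
  set e := trivializationAt E (TangentSpace 𝓘(ℝ, E)) p
  have h := e.continuousLinearMapAt_apply_of_mem (R := ℝ) hx
  have h1 : (e (fibreContraction p a t x)).2 = e.continuousLinearMapAt ℝ x.proj
      ((1 - t) • e.symmL ℝ x.proj (e (fibreInclusion E p a)).2 + t • x.2) := (h _).symm
  have h2 := h x.2
  rw [h1, map_add, map_smul, map_smul, e.continuousLinearMapAt_symmL hx, h2]

theorem fibreContraction_apply (p : M) (a : E) (t : ℝ) (w : E) :
    fibreContraction p a t (fibreInclusion E p w) = fibreInclusion E p ((1 - t) • a + t • w) := by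
  have hp : p ∈ (trivializationAt E (TangentSpace 𝓘(ℝ, E)) p).baseSet :=
    FiberBundle.mem_baseSet_trivializationAt' p
  set e := trivializationAt E (TangentSpace 𝓘(ℝ, E)) p
  have h1 : (e (fibreInclusion E p a)).2 = e.continuousLinearMapAt ℝ p a :=
    (e.continuousLinearMapAt_apply_of_mem (R := ℝ) hp a).symm
  have h2 : e.symmL ℝ p (e (fibreInclusion E p a)).2 = a :=
    (congrArg (e.symmL ℝ p) h1).trans (e.symmL_continuousLinearMapAt hp a)
  exact congrArg (fun b : E => fibreInclusion E p ((1 - t) • b + t • w)) h2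

theorem continuousAt_fibreContraction (p : M) (a : E) (t : ℝ) (w : E) :
    ContinuousAt (fibreContraction p a t) (fibreInclusion E p w) := by
  have hid := (FiberBundle.continuousAt_totalSpace (F := E) (E := TangentSpace 𝓘(ℝ, E)) id
    (x₀ := fibreInclusion E p w)).mp continuousAt_id
  refine (FiberBundle.continuousAt_totalSpace (F := E) (E := TangentSpace 𝓘(ℝ, E))
    (fibreContraction p a t)).mpr ⟨hid.1, ?_⟩
  have hp : p ∈ (trivializationAt E (TangentSpace 𝓘(ℝ, E)) p).baseSet :=
    FiberBundle.mem_baseSet_trivializationAt' p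
  refine ((hid.2.const_smul t).const_add ((1 - t) •
    (trivializationAt E (TangentSpace 𝓘(ℝ, E)) p (fibreInclusion E p a)).2)).congr ?_
  filter_upwards [hid.1.eventually
    ((trivializationAt E (TangentSpace 𝓘(ℝ, E)) p).open_baseSet.mem_nhds hp)] with x hx
  exact (trivializationAt_fibreContraction p a t hx).symm

/-! ### The cone structure of a Lorentz-Finsler metric -/

namespace IsLorentzFinslerMetric

variable [FiniteDimensional ℝ E]

/-- Concavity of `√L` in the fibre of `x`, with the term `t √(L x)` dropped: the bound does not
degrade as `x` tends to the boundary. -/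
theorem le_fibreContraction (h : IsLorentzFinslerMetric k A L) (hk : 2 ≤ k) {p : M} {a : E} {t : ℝ}
    (ht : t ∈ Icc (0 : ℝ) 1) {x : TangentBundle 𝓘(ℝ, E) M} (hx : x ∈ A)
    (hx0 : fibreContraction p a 0 x ∈ A) :
    fibreContraction p a t x ∈ A ∧
      (1 - t) ^ 2 * L (fibreContraction p a 0 x) ≤ L (fibreContraction p a t x) := by
  obtain ⟨q, y, rfl⟩ : ∃ (q : M) (y : E), x = fibreInclusion E q y := ⟨x.proj, x.2, rfl⟩
  set b : E := (trivializationAt E (TangentSpace 𝓘(ℝ, E)) p).symmL ℝ q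
    (trivializationAt E (TangentSpace 𝓘(ℝ, E)) p (fibreInclusion E p a)).2
  have h0 : fibreContraction p a 0 (fibreInclusion E q y) = fibreInclusion E q b := by
    change fibreInclusion E q (((1 : ℝ) - 0) • b + (0 : ℝ) • y) = _
    rw [sub_zero, one_smul, zero_smul, add_zero]
  have h1 : fibreContraction p a t (fibreInclusion E q y) =
    fibreInclusion E q ((1 - t) • b + t • y) := rfl
  rw [h0] at hx0 ⊢
  rw [h1]
  have hconc := (h.properlyLorentzMinkowski q).concaveOn_sqrt hk
  have hbA : b ∈ fibreAt A q := hx0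
  have hyA : y ∈ fibreAt A q := hx
  have ht' : 0 ≤ 1 - t := by linarith [ht.2]
  have hmem : (1 - t) • b + t • y ∈ fibreAt A q := hconc.1 hbA hyA ht' ht.1 (by ring)
  refine ⟨hmem, ?_⟩
  have h2 : (1 - t) * √(L (fibreInclusion E q b)) + t * √(L (fibreInclusion E q y)) ≤
      √(L (fibreInclusion E q ((1 - t) • b + t • y))) :=
    hconc.2 hbA hyA ht' ht.1 (by ring)
  have h3 : (1 - t) * √(L (fibreInclusion E q b)) ≤
      √(L (fibreInclusion E q ((1 - t) • b + t • y))) := by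
    have := mul_nonneg ht.1 (Real.sqrt_nonneg (L (fibreInclusion E q y)))
    linarith
  calc (1 - t) ^ 2 * L (fibreInclusion E q b)
      = ((1 - t) * √(L (fibreInclusion E q b))) ^ 2 := by
        rw [mul_pow, Real.sq_sqrt (h.pos _ hx0).le]
    _ ≤ √(L (fibreInclusion E q ((1 - t) • b + t • y))) ^ 2 := by gcongr
    _ = _ := Real.sq_sqrt (h.pos _ hmem).le

/-- The point is a limit of contractions of points of `A` on which `L` is bounded below by a
positive constant. Were it outside `A`, it would be a boundary point, where `L` extends continuously
by zero. -/
theorem segment_mem_fibreAt (h : IsLorentzFinslerMetric k A L) (hk : 2 ≤ k) {p : M} {a w : E}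
    (ha : a ∈ fibreAt A p) (hw : fibreInclusion E p w ∈ closure A) {t : ℝ} (ht0 : 0 ≤ t)
    (ht1 : t < 1) (hne : (1 - t) • a + t • w ≠ 0) : (1 - t) • a + t • w ∈ fibreAt A p := by
  change fibreInclusion E p ((1 - t) • a + t • w) ∈ A
  by_contra hnA
  have hG := continuousAt_fibreContraction p a t w
  have hG0 := continuousAt_fibreContraction p a 0 w
  rw [ContinuousAt, fibreContraction_apply] at hG hG0
  rw [sub_zero, one_smul, zero_smul, add_zero] at hG0
  have ha' : fibreInclusion E p a ∈ A := ha
  have hLa : ContinuousAt L (fibreInclusion E p a) :=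
    h.contMDiffOn.continuousOn.continuousAt (h.isOpen.mem_nhds ha')
  set c := L (fibreInclusion E p a) / 2 with hc
  have hLpos := h.pos _ ha'
  have hcL : c < L (fibreInclusion E p a) := by linarith
  have hev : ∀ᶠ x in 𝓝[A] (fibreInclusion E p w), fibreContraction p a t x ∈ A ∧
      (1 - t) ^ 2 * c ≤ L (fibreContraction p a t x) := by
    rw [eventually_nhdsWithin_iff]
    filter_upwards [hG0.eventually (h.isOpen.mem_nhds ha'),
      hG0.eventually (hLa.eventually (lt_mem_nhds hcL))] with x h1 h2 hx
    obtain ⟨h3, h4⟩ := h.le_fibreContraction hk ⟨ht0, ht1.le⟩ hx h1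
    refine ⟨h3, le_trans ?_ h4⟩
    gcongr
  have hnb : (𝓝[A] (fibreInclusion E p w)).NeBot := mem_closure_iff_nhdsWithin_neBot.mp hw
  have hG' := hG.mono_left (nhdsWithin_le_nhds (s := A))
  have hcl := mem_closure_of_tendsto hG' (hev.mono fun _ hx => hx.1)
  have hbd : fibreInclusion E p ((1 - t) • a + t • w) ∈ tangentBoundary A :=
    ⟨⟨hcl, by rwa [h.isOpen.interior_eq]⟩, hne⟩
  obtain ⟨U, f, hU, hvU, hf, hfL, hf0⟩ := h.extends_zero _ hbd
  have hfc := (hf.continuousOn.continuousAt (hU.mem_nhds hvU)).tendsto.comp hG'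
  rw [hf0 _ ⟨hbd, hvU⟩] at hfc
  have hle : (1 - t) ^ 2 * c ≤ 0 := by
    refine ge_of_tendsto hfc ?_
    filter_upwards [hev, hG'.eventually (hU.mem_nhds hvU)] with x hx hxU
    rw [Function.comp_apply, hfL _ ⟨hx.1, hxU⟩]
    exact hx.2
  have : 0 < (1 - t) ^ 2 * c := by
    have : 0 < 1 - t := by linarith
    positivity
  linarith

/-- The boundary of the domain in `TM` restricts to the boundary in each fibre. -/
theorem fibreAt_tangentBoundary (h : IsLorentzFinslerMetric k A L) (hk : 2 ≤ k)
    (hdim : 2 ≤ finrank ℝ E) (p : M) :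
    fibreAt (tangentBoundary A) p = puncturedBoundary (fibreAt A p) := by
  refine Subset.antisymm ?_ (puncturedBoundary_fibreAt_subset h.isOpen p)
  rintro w ⟨hw, hw0⟩
  have hopen := isOpen_fibreAt h.isOpen p
  refine ⟨⟨?_, ?_⟩, hw0⟩
  -- Taking `a` off the line of `w` makes the segment avoid the zero vector.
  · obtain ⟨a, ha, haw⟩ : ∃ a ∈ fibreAt A p, a ∉ Submodule.span ℝ {w} := by
      by_contra! hsub
      have htop := (Submodule.span ℝ {w}).eq_top_of_nonempty_interior'
        ((h.properlyLorentzMinkowski p).nonempty.mono (hopen.subset_interior_iff.mpr hsub))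
      have h1 := finrank_span_singleton (K := ℝ) (show w ≠ 0 from hw0)
      rw [htop, finrank_top] at h1
      omega
    have hmem : ∀ t : ℝ, 0 ≤ t → t < 1 → (1 - t) • a + t • w ∈ fibreAt A p := by
      intro t ht0 ht1
      refine h.segment_mem_fibreAt hk ha (frontier_subset_closure hw) ht0 ht1 fun h0 => haw ?_
      have ht : 1 - t ≠ 0 := by linarith
      refine Submodule.mem_span_singleton.mpr ⟨-(t / (1 - t)), ?_⟩
      have h2 : (1 - t) • a = (1 - t) • (-(t / (1 - t)) • w) := by
        rw [smul_smul, mul_neg, mul_div_cancel₀ _ ht, neg_smul]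
        exact eq_neg_of_add_eq_zero_left h0
      exact (smul_right_injective E ht h2).symm
    have hc : Continuous fun t : ℝ => (1 - t) • a + t • w := by fun_prop
    have ht : Tendsto (fun t : ℝ => (1 - t) • a + t • w) (𝓝[<] 1) (𝓝 w) := by
      simpa using (hc.tendsto 1).mono_left nhdsWithin_le_nhds
    refine mem_closure_of_tendsto ht ?_
    filter_upwards [Ioo_mem_nhdsLT (zero_lt_one' ℝ)] with t ht using hmem t ht.1.le ht.2
  · rw [hopen.interior_eq]
    have := hw.2
    rwa [h.isOpen.interior_eq] at this

/-- The boundary of the domain of a Lorentz-Finsler metric is transverse to the fibres. -/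
theorem isTransverseToFibres (h : IsLorentzFinslerMetric k A L) (hk : 2 ≤ k)
    (hdim : 2 ≤ finrank ℝ E) : IsTransverseToFibres k (tangentBoundary A) := by
  intro v hv U φ hφ
  obtain ⟨p, w, rfl⟩ : ∃ (p : M) (w : E), v = fibreInclusion E p w := ⟨v.proj, v.2, rfl⟩
  have hk' : (2 : ℕ∞ω) ≤ k := WithTop.coe_le_coe.mpr hk
  obtain ⟨W, f, hW, hvW, hf, hfL, hf0⟩ := h.extends_zero _ hv
  have hφ2 := (hφ.contMDiffOn.contMDiffAt (hφ.isOpen.mem_nhds hφ.mem)).of_le hk'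
  have hf2 : ContMDiffAt 𝓘(ℝ, E).tangent 𝓘(ℝ, ℝ) 2 f (fibreInclusion E p w) :=
    (hf.contMDiffAt (hW.mem_nhds hvW)).of_le hk'
  have hker := mfderiv_eq_zero_of_zero_set_subset hφ2 hf2
    (hφ.inter_eq.subset ⟨hv, hφ.mem⟩).2 hφ.mfderiv_ne_zero (by
      filter_upwards [hφ.isOpen.mem_nhds hφ.mem, hW.mem_nhds hvW] with x hxU hxW hx0
      exact hf0 x ⟨(hφ.inter_eq.superset ⟨hxU, hx0⟩).1, hxW⟩)
  have hwb : w ∈ puncturedBoundary (fibreAt A p) :=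
    (h.fibreAt_tangentBoundary hk hdim p).subset hv
  obtain ⟨f₀, hf₀⟩ := (h.properlyLorentzMinkowski p).exists_isLorentzExtension hk hwb
  have hi := contMDiff_fibreInclusion (E := E) p 2 w
  have hfi : ContDiffAt ℝ 2 (f ∘ fibreInclusion E p) w :=
    contMDiffAt_iff_contDiffAt.mp (ContMDiffAt.comp w hf2 hi)
  -- The differential is known to be nonzero only for the extension `f₀` in the fibre; both
  -- extensions agree with `L` on `A_p`, hence have the same differential at `w`.
  have hd : fderiv ℝ (f ∘ fibreInclusion E p) w = fderiv ℝ f₀ w := by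
    refine fderiv_eq_of_eventually_eq_of_mem_closure (isOpen_fibreAt h.isOpen p) hfi
      hf₀.contDiffAt (frontier_subset_closure hwb.1) ?_
    filter_upwards [hf₀.eventually_eq, (continuous_fibreInclusion p).continuousAt.eventually
      (hW.mem_nhds hvW)] with x h1 h2 hx
    rw [h1 hx]
    exact hfL _ ⟨hx, h2⟩
  obtain ⟨X, hX⟩ : ∃ X, fderiv ℝ f₀ w X ≠ 0 := by
    by_contra! h0
    exact hf₀.fderiv_ne_zero (ContinuousLinearMap.ext h0)
  have hcomp := mfderiv_comp_apply w (hf2.mdifferentiableAt (by norm_num))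
    (hi.mdifferentiableAt (by norm_num)) X
  rw [mfderiv_eq_fderiv, hd] at hcomp
  -- The vertical vector given by `X` is not in the kernel of `df`, hence not in that of `dφ`.
  exact ker_sup_ker_eq_top _ _ (mfderiv_proj_mfderiv_fibreInclusion p w X)
    fun h0 => hX (hcomp.trans (hker _ h0))

/-- The boundary of the domain of a Lorentz-Finsler metric is a strong cone structure. -/
theorem isConeStructure (h : IsLorentzFinslerMetric k A L) (hk : 2 ≤ k) (hdim : 2 ≤ finrank ℝ E) :
    IsConeStructure k (tangentBoundary A) A where
  hypersurface v hv := by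
    obtain ⟨U, φ, hφ, -⟩ := h.smooth_boundary v hv
    exact ⟨U, φ, hφ⟩
  transverse := h.isTransverseToFibres hk hdim
  strongCone p := by
    rw [h.fibreAt_tangentBoundary hk hdim p]
    exact (h.properlyLorentzMinkowski p).isStrongCone hk hdim

end IsLorentzFinslerMetric

end TangentBundle

theorem mainTheorem7 (k : ℕ∞) (hk : 2 ≤ k) :
    (∀ (V : Type*) [NormedAddCommGroup V] [NormedSpace ℝ V] [FiniteDimensional ℝ V],
      2 ≤ finrank ℝ V → ∀ (A₀ : Set V) (L₀ : V → ℝ),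
        IsProperlyLorentzMinkowskiNorm k A₀ L₀ → IsStrongCone k (puncturedBoundary A₀) A₀) ∧
    (∀ (E : Type*) [NormedAddCommGroup E] [NormedSpace ℝ E] [FiniteDimensional ℝ E]
      (M : Type*) [TopologicalSpace M] [ChartedSpace E M]
      [IsManifold 𝓘(ℝ, E) 1 M] [IsManifold 𝓘(ℝ, E) ((k : ℕ∞ω) + 1) M],
      2 ≤ finrank ℝ E →
        ∀ (A : Set (TangentBundle 𝓘(ℝ, E) M)) (L : TangentBundle 𝓘(ℝ, E) M → ℝ),
          IsLorentzFinslerMetric k A L → IsConeStructure k (tangentBoundary A) A) :=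
  ⟨fun _ _ _ _ hdim _ _ h => h.isStrongCone hk hdim,
    fun _ _ _ _ _ _ _ _ _ hdim _ _ h => h.isConeStructure hk hdim⟩
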